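/- Let $k\ge 1$ and $I=[-1,1]$. Let $\mathcal P$ be the set of analytic even maps $f:I\to I$ with $f(0)=1$, $xf'(x)<0$ and $Sf(x)=\frac{f'''(x)}{f'(x)}-\frac32\bigl(\frac{f''(x)}{f'(x)}\bigr)^2<0$ for $x\in I\setminus\{0\}$, and, with $\lambda_f=f(1)$ and $b_f=f(\lambda_f)$, $0<|\lambda_f|<b_f$ and $0<f(b_f)<|\lambda_f|$. For $f\in\mathcal P$ put $Tf(x)=\lambda_f^{-1}f(f(\lambda_f x))$. Let $g=g_k\in\mathcal P$ be concave on $I$ with $Tg=g$ and $g(x)=h(x^{2k})$ for $x\in I$, where $h$ is analytic on $[0,1]$ and $h'(0)\neq0$, and put $\lambda_k=\lambda_g$. Let $D\subset\mathbb C$ be a bounded domain containing $I$ such that $g-1$ belongs to the space $\mathcal G_k$ of functions $z^{2k}\hat f(z)$ with $\hat f$ analytic on $D$ and continuous on $\overline D$, $\overline{\lambda_kD}\subset D$, $\overline{g(\lambda_kD)}\subset D$, and the closure of $\{-g'(g(\lambda_kz)):z\in D\}$ lies in $\mathbb C\setminus(-\infty,0]$. Elements of $(\mathcal G_k+1)\cap\mathcal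 P$ are understood to be real on $D\cap\mathbb R$. Let $\mathcal W_s(g_k)$ be the set of $f$ all of whose renormalizations $T^nf$ $(n\ge0)$ are defined, extend to $D$ as elements of $(\mathcal G_k+1)\cap\mathcal P$, and converge to $g_k$ exponentially fast in the sup norm on $\overline D$. Let $H^r$ be the real Banach space of bounded continuous functions on $\overline D$ that are analytic on $D$ and real on $D\cap\mathbb R$, with the sup norm, and for $p\ge0$ let $$\mathcal K_{f,p}h(z)=\frac1{(-\lambda_f)^p}\Bigl[\bigl(-f'(f(\lambda_fz))\bigr)^p\,h(\lambda_fz)+h(f(\lambda_fz))\Bigr]$$ (principal power) be the period-doubling Lindeberg--Lyapunov operator. There is $\varepsilon>0$ such that for every $f\in\mathcal W_s(g_k)$ with $|f-g_k|<\varepsilon$ on $\overline D$, the operators $\mathcal K_{f,p}$, $p\ge 0$, are well-defined bounded operators on $H^r$, and their spectral radii $\rho_p$ satisfy the following. (S1) $(\lambda_f^{-1}f'(1))^p<\rho_p$ for all $p\ge0$, and $\rho_p<(\lambda_f^{-1}f'(1))^p+(-\lambda_f)^{-p}$ for all $p>0$. In particular, if $f=g_k$, then $1<\lambda_k^{2kp}\rho_p$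 for all $p\ge0$ and $\lambda_k^{2kp}\rho_p<1+(-\lambda_k)^{(2k-1)p}$ for all $p>0$, where $\lambda_k^{2kp}=(\lambda_k^{2k})^p$. (S2) On $[0,\infty)$ the map $p\mapsto\rho_p$ is strictly increasing and strictly log-convex. (S3) On $(0,\infty)$ the map $p\mapsto\log(\rho_p)/p$ is strictly decreasing; in particular $\rho_p<\rho_2^{p/2}$ for all $p>2$. -/

import Mathlib

open Set TensorProduct
open scoped BoundedContinuousFunction

noncomputable section

namespace PeriodDoubling

/-! ### Interval maps and the period doubling renormalization operator -/

/-- The interval `I = [-1, 1]`. -/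
abbrev unitI : Set ℝ := Icc (-1) 1

/-- The Schwarzian derivative `φ''' / φ' - (3/2) (φ'' / φ')²`. -/
def schwarzian (φ : ℝ → ℝ) (x : ℝ) : ℝ :=
  iteratedDeriv 3 φ x / deriv φ x - (3 / 2) * (iteratedDeriv 2 φ x / deriv φ x) ^ 2

/-- The class `𝒫` of period doubling renormalizable unimodal maps of `[-1, 1]`,
with `λ_φ = φ 1` and `b_φ = φ (λ_φ)`. -/
structure Renormalizable (φ : ℝ → ℝ) : Prop where
  analytic : AnalyticOnNhd ℝ φ unitI
  even : ∀ x ∈ unitI, φ (-x) = φ x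
  mapsTo : MapsTo φ unitI unitI
  map_zero : φ 0 = 1
  unimodal : ∀ x ∈ unitI, x ≠ 0 → x * deriv φ x < 0
  schwarzian_neg : ∀ x ∈ unitI, x ≠ 0 → schwarzian φ x < 0
  lam_pos : 0 < |φ 1|
  lam_lt : |φ 1| < φ (φ 1)
  image_pos : 0 < φ (φ (φ 1))
  image_lt : φ (φ (φ 1)) < |φ 1|

/-- The renormalization operator `T φ (x) = φ (φ (λ_φ x)) / λ_φ`, `λ_φ = φ 1`. -/
def renorm (φ : ℝ → ℝ) (x : ℝ) : ℝ := φ (φ (φ 1 * x)) / φ 1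

/-! ### Analytic maps on a complex domain

A map `f` of the universality class lives on the closure of a domain `D ⊆ ℂ` that contains
`[-1, 1]`; it is represented by a function `ℂ → ℂ` of which only the values on `closure D`
matter. -/

/-- The interval map given by a complex map that is real on `[-1, 1]`. -/
def realTrace (f : ℂ → ℂ) (x : ℝ) : ℝ := (f (x : ℂ)).re

/-- The number `λ_f = f 1`. -/
def lam (f : ℂ → ℂ) : ℝ := realTrace f 1

/-- The set `(𝒢_k + 1) ∩ 𝒫`: maps `f(z) = 1 + z ^ (2k) q(z)` with `q` analytic on `D` and
continuous on the closure of `D`, real at the real points of `D`, whose restriction to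
`[-1, 1]` is period doubling renormalizable. -/
structure MemClass (k : ℕ) (D : Set ℂ) (f : ℂ → ℂ) : Prop where
  factor : ∃ q : ℂ → ℂ, DiffContOnCl ℂ q D ∧ ∀ z ∈ closure D, f z = 1 + z ^ (2 * k) * q z
  real : ∀ x : ℝ, (x : ℂ) ∈ D → (f x).im = 0
  renormalizable : Renormalizable (realTrace f)

/-- `g` is a period doubling fixed point of order exactly `2k`, and `D` is an open bounded
domain containing `[-1, 1]` on which it is considered: `D` is mapped well inside itself by
`z ↦ λ_g z` and by `z ↦ g (λ_g z)`, and the weight `-g' (g (λ_g z))` stays in the domain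
`ℂ ∖ (-∞, 0]` of the principal logarithm. -/
structure IsFixedPoint (k : ℕ) (g : ℂ → ℂ) (D : Set ℂ) : Prop where
  isOpen : IsOpen D
  isConnected : IsConnected D
  isBounded : Bornology.IsBounded D
  interval_subset : ∀ x ∈ unitI, (x : ℂ) ∈ D
  memClass : MemClass k D g
  fixed : ∀ x ∈ unitI, renorm (realTrace g) x = realTrace g x
  order : ∃ h : ℝ → ℝ, AnalyticOnNhd ℝ h (Icc 0 1) ∧ deriv h 0 ≠ 0 ∧
    ∀ x ∈ unitI, realTrace g x = h (x ^ (2 * k))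
  concave : ConcaveOn ℝ unitI (realTrace g)
  closure_scale : closure ((fun z : ℂ => (lam g : ℂ) * z) '' D) ⊆ D
  closure_image : closure ((fun z : ℂ => g ((lam g : ℂ) * z)) '' D) ⊆ D
  closure_weight :
    closure ((fun z : ℂ => -deriv g (g ((lam g : ℂ) * z))) '' D) ⊆ Complex.slitPlane

/-- The universality class (stable manifold) `𝒲_s(g)`: the maps `f` all of whose
renormalizations `Tⁿ f` are defined, belong to `(𝒢_k + 1) ∩ 𝒫`, and converge to `g`
exponentially fast in the sup norm on the closure of `D`. Here `F n` is `Tⁿ f`; it is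
determined on `closure D` by its values on `[-1, 1]`. -/
def stableManifold (k : ℕ) (g : ℂ → ℂ) (D : Set ℂ) : Set (ℂ → ℂ) :=
  {f | ∃ F : ℕ → ℂ → ℂ, F 0 = f ∧ (∀ n, MemClass k D (F n)) ∧
    (∀ n, ∀ x ∈ unitI, realTrace (F (n + 1)) x = renorm (realTrace (F n)) x) ∧
    ∃ C ω : ℝ, 0 < ω ∧ ω < 1 ∧ ∀ n, ∀ z ∈ closure D, ‖F n z - g z‖ ≤ C * ω ^ n}

/-! ### The real Banach space `H^r` -/

/-- A function on the closure of `D`, extended by zero to `ℂ`. -/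
def zeroExt {D : Set ℂ} (h : closure D → ℂ) : ℂ → ℂ := Function.extend Subtype.val h 0

theorem zeroExt_apply {D : Set ℂ} (h : closure D → ℂ) (z : closure D) :
    zeroExt h (z : ℂ) = h z :=
  Subtype.val_injective.extend_apply h 0 z

theorem zeroExt_of_mem {D : Set ℂ} (h : closure D → ℂ) {z : ℂ} (hz : z ∈ D) :
    zeroExt h z = h ⟨z, subset_closure hz⟩ :=
  zeroExt_apply h ⟨z, subset_closure hz⟩

/-- The space `H^r` of bounded continuous functions on the closure of `D` that are
analytic on `D` and real at the real points of `D`, with the sup norm. -/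
def Hr (D : Set ℂ) : Submodule ℝ (closure D →ᵇ ℂ) where
  carrier := {h | DifferentiableOn ℂ (zeroExt h) D ∧
    ∀ x : ℝ, (x : ℂ) ∈ D → (zeroExt h x).im = 0}
  add_mem' := by
    rintro a b ⟨ha, ha'⟩ ⟨hb, hb'⟩
    refine ⟨(ha.add hb).congr fun z hz => ?_, fun x hx => ?_⟩
    · simp [zeroExt_of_mem _ hz]
    · have h1 := ha' x hx
      have h2 := hb' x hx
      rw [zeroExt_of_mem _ hx] at h1 h2 ⊢
      simp [h1, h2]
  zero_mem' := by
    refine ⟨(differentiableOn_const (0 : ℂ)).congr fun z hz => ?_, fun x hx => ?_⟩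
    · simp [zeroExt_of_mem _ hz]
    · simp [zeroExt_of_mem _ hx]
  smul_mem' := by
    rintro c a ⟨ha, ha'⟩
    refine ⟨(ha.const_smul c).congr fun z hz => ?_, fun x hx => ?_⟩
    · simp [zeroExt_of_mem _ hz]
    · have h1 := ha' x hx
      rw [zeroExt_of_mem _ hx] at h1 ⊢
      simp [h1]

/-! ### The Lindeberg–Lyapunov operators -/

/-- `K` is the Lindeberg–Lyapunov operator of `f` with exponent `p` on `H^r`: the maps
`z ↦ λ_f z` and `z ↦ f (λ_f z)` send the closure of `D` into `D`, the power
`(-f' (f (λ_f z))) ^ p` is given by the principal logarithm, and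
`K h (z) = (-λ_f)^{-p} [ (-f' (f (λ_f z))) ^ p h (λ_f z) + h (f (λ_f z)) ]`. -/
structure IsLindebergLyapunov (D : Set ℂ) (f : ℂ → ℂ) (p : ℝ) (K : Hr D →L[ℝ] Hr D) :
    Prop where
  scale : ∀ z ∈ closure D, (lam f : ℂ) * z ∈ D
  image : ∀ z ∈ closure D, f ((lam f : ℂ) * z) ∈ D
  weight : ∀ z ∈ closure D, -deriv f (f ((lam f : ℂ) * z)) ∈ Complex.slitPlane
  formula : ∀ (h : Hr D) (z : closure D), (K h).1 z =
    1 / (((-lam f) ^ p : ℝ) : ℂ) *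
      ((-deriv f (f ((lam f : ℂ) * z))) ^ (p : ℂ) * zeroExt h.1 ((lam f : ℂ) * z)
        + zeroExt h.1 (f ((lam f : ℂ) * z)))

theorem IsLindebergLyapunov.unique {D : Set ℂ} {f : ℂ → ℂ} {p : ℝ} {K L : Hr D →L[ℝ] Hr D}
    (hK : IsLindebergLyapunov D f p K) (hL : IsLindebergLyapunov D f p L) : K = L := by
  ext h z
  rw [hK.formula, hL.formula]

open Classical in
/-- The Lindeberg–Lyapunov operator `𝒦_{f,p}` on `H^r` (zero if it is not well defined). -/
def lindebergLyapunov (D : Set ℂ) (f : ℂ → ℂ) (p : ℝ) : Hr D →L[ℝ] Hr D :=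
  if h : ∃ K, IsLindebergLyapunov D f p K then h.choose else 0

/-- The spectral radius of a bounded operator on a real normed space: the largest modulus
of a point of the complex spectrum, which is the spectrum of the complexified operator
`1 ⊗ K` in the complexification `ℂ ⊗ (X → X)` of the algebra of bounded operators. -/
def opSpectralRadius {X : Type*} [NormedAddCommGroup X] [NormedSpace ℝ X] (K : X →L[ℝ] X) :
    ℝ :=
  (spectralRadius ℂ ((1 : ℂ) ⊗ₜ[ℝ] K)).toReal

/-- The spectral radius `ρ_p` of `𝒦_{f,p}`. -/
def rho (D : Set ℂ) (f : ℂ → ℂ) (p : ℝ) : ℝ := opSpectralRadius (lindebergLyapunov D f p)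

end PeriodDoubling

end

namespace PeriodDoubling

open Filter Topology

/-! ### Positive two-branch transfer operators on an interval -/

/-! Write `l = -λ_f`, `σ x = f (λ_f x)` and `w x = -f' (σ x)`. On `[-1, 1]` the operator sends `u`
to `l ^ (-p) (w ^ p u(-l x) + u (σ x))`, a transfer operator with positive weights, and everything
rests on comparing positive sub- and supersolutions (`rate_le_of_sub_super`).

Spectral part. Both branches send the closure of `D` into `D`, so the operator on `H^r` is compact.
The least rate of a positive supersolution on the interval bounds the modulus of the complex
spectrum. Compactness, applied to normalized resolvents of `1`, makes it an eigenvalue with an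
eigenfunction positive on the interval (`exists_eigenfunction`, `opSpectralRadius_op`). Thus `ρ p`
is an eigenvalue with a positive eigenfunction `h p`, and any test function on the interval bounds
it.

Interval part. Evaluating the eigenvalue equation at `0`, the fixed point of `x ↦ -l x`, gives the
lower bound. Since `w > 1` and `l < 1`, `h p` is a subsolution for every larger exponent, whence
monotonicity. By Hölder, `h p ^ a * h q ^ b` is a supersolution for the interpolated exponent,
whence log-convexity. The upper bound needs an explicit supersolution (`upper`): the weight is
almost maximal at `0`, while `σ` maps the interval away from `0`.

Strictness. The excess `log (ρ p) - p log (w 0 / l)` is convex, positive, and tends to `0` by the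
upper bound, so it strictly decreases (`excess_lt`). Equality in Hölder propagates along `(-l) ^ n
x` to `0`, where it forces equal excesses at the two exponents, a contradiction
(`eq_of_rho_interpolate`). Dividing by `p` gives the monotonicity of `log (ρ p) / p`.

Perturbation. For `g`, concavity and the negative Schwarzian give `w > 1` and a strict maximum of
`w` at `0`. Uniform closeness to `g` controls `f`, `f'` and `f''` on compact subsets of `D`, so the
inequalities used persist, the maximum at `0` in the weakened form `WeightDominated`. At the fixed
point, differentiating `Tg = g` in the variable `x ^ (2 * k)` identifies the multiplier
(`lam_pow_mul`). -/

/-- Comparison principle for a positive two-branch transfer operator: a positive supersolution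
with rate `t` and a subsolution with rate `s` that it dominates satisfy `s ≤ t`. -/
theorem rate_le_of_sub_super {I : Set ℝ} {a₁ a₂ s₁ s₂ u v : ℝ → ℝ} {s t M x₀ : ℝ}
    (hs₁ : MapsTo s₁ I I) (hs₂ : MapsTo s₂ I I)
    (ha₁ : ∀ x ∈ I, 0 ≤ a₁ x) (ha₂ : ∀ x ∈ I, 0 ≤ a₂ x) (hs : 0 < s) (ht : 0 ≤ t)
    (hu : ∀ x ∈ I, a₁ x * u (s₁ x) + a₂ x * u (s₂ x) ≤ t * u x)
    (hv : ∀ x ∈ I, s * v x ≤ a₁ x * v (s₁ x) + a₂ x * v (s₂ x))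
    (hM₀ : 0 ≤ M) (hM : ∀ x ∈ I, v x ≤ M * u x) (hx₀ : x₀ ∈ I) (hvx₀ : 0 < v x₀) : s ≤ t := by
  by_contra! hlt
  -- Each application of the operator improves the domination constant by `t / s`; if `t < s`, the
  -- limit contradicts `0 < v x₀`.
  have key : ∀ n : ℕ, ∀ x ∈ I, v x ≤ M * (t / s) ^ n * u x := by
    intro n
    induction n with
    | zero => intro x hx; simpa using hM x hx
    | succ n ih =>
      intro x hx
      have hc : 0 ≤ M * (t / s) ^ n := by positivity
      have h1 : s * v x ≤ M * (t / s) ^ n * (t * u x) := by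
        calc s * v x ≤ a₁ x * v (s₁ x) + a₂ x * v (s₂ x) := hv x hx
          _ ≤ a₁ x * (M * (t / s) ^ n * u (s₁ x)) + a₂ x * (M * (t / s) ^ n * u (s₂ x)) :=
            add_le_add (mul_le_mul_of_nonneg_left (ih _ (hs₁ hx)) (ha₁ x hx))
              (mul_le_mul_of_nonneg_left (ih _ (hs₂ hx)) (ha₂ x hx))
          _ = M * (t / s) ^ n * (a₁ x * u (s₁ x) + a₂ x * u (s₂ x)) := by ring
          _ ≤ _ := mul_le_mul_of_nonneg_left (hu x hx) hc
      have h2 : v x ≤ M * (t / s) ^ n * (t * u x) / s := by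
        rw [le_div_iff₀ hs]; linarith
      refine h2.trans (le_of_eq ?_)
      rw [pow_succ]; field_simp
  have hlim : Tendsto (fun n : ℕ => M * (t / s) ^ n * u x₀) atTop (𝓝 (M * 0 * u x₀)) :=
    ((tendsto_pow_atTop_nhds_zero_of_lt_one (by positivity)
      ((div_lt_one hs).2 hlt)).const_mul M).mul_const _
  have := ge_of_tendsto' hlim fun n => key n x₀ hx₀
  simp at this
  linarith

/-- A positive function on the compact interval dominates every bounded one up to a factor. -/
theorem exists_le_mul_of_pos {v h : ℝ → ℝ} {B : ℝ} (hv : ∀ x ∈ unitI, v x ≤ B)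
    (hc : ContinuousOn h unitI) (hh : ∀ x ∈ unitI, 0 < h x) :
    ∃ M, 0 ≤ M ∧ ∀ x ∈ unitI, v x ≤ M * h x := by
  obtain ⟨y, hy, hmin⟩ := isCompact_Icc.exists_isMinOn (s := unitI) ⟨0, by simp⟩ hc
  refine ⟨|B| / h y, div_nonneg (abs_nonneg _) (hh y hy).le, fun x hx => ?_⟩
  have h1 : h y ≤ h x := hmin hx
  have h2 := hh y hy
  calc v x ≤ |B| := (hv x hx).trans (le_abs_self _)
    _ = |B| / h y * h y := by field_simp
    _ ≤ _ := by gcongr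

theorem exists_bound_of_continuousOn {h : ℝ → ℝ} (hc : ContinuousOn h unitI) :
    ∃ B, ∀ x ∈ unitI, h x ≤ B := by
  obtain ⟨B, hB⟩ := isCompact_Icc.bddAbove_image hc
  exact ⟨B, fun x hx => hB (mem_image_of_mem h hx)⟩

/-! ### Two-term Hölder inequality and its equality case -/

/-- Strict weighted arithmetic–geometric mean inequality for two numbers. -/
theorem rpow_mul_rpow_lt {X Y a b : ℝ} (hX : 0 < X) (hY : 0 < Y) (ha : 0 < a) (hb : 0 < b)
    (hab : a + b = 1) (hne : X ≠ Y) : X ^ a * Y ^ b < a * X + b * Y := by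
  have h := strictConcaveOn_log_Ioi.2 (mem_Ioi.2 hX) (mem_Ioi.2 hY) hne ha hb hab
  simp only [smul_eq_mul] at h
  have hpos : 0 < a * X + b * Y := by positivity
  rw [← Real.log_lt_log_iff (by positivity) hpos,
    Real.log_mul (by positivity) (by positivity), Real.log_rpow hX, Real.log_rpow hY]
  exact h

/-- Hölder's inequality for two terms. -/
theorem two_term_holder {x₁ x₂ y₁ y₂ a b : ℝ} (hx₁ : 0 < x₁) (hx₂ : 0 < x₂) (hy₁ : 0 < y₁)
    (hy₂ : 0 < y₂) (ha : 0 < a) (hb : 0 < b) (hab : a + b = 1) :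
    x₁ ^ a * y₁ ^ b + x₂ ^ a * y₂ ^ b ≤ (x₁ + x₂) ^ a * (y₁ + y₂) ^ b := by
  have hx : 0 < x₁ + x₂ := by positivity
  have hy : 0 < y₁ + y₂ := by positivity
  -- Normalizing by the totals makes the two arithmetic means add up to `a + b = 1`.
  have h1 := Real.geom_mean_le_arith_mean2_weighted ha.le hb.le (div_pos hx₁ hx).le
    (div_pos hy₁ hy).le hab
  have h2 := Real.geom_mean_le_arith_mean2_weighted ha.le hb.le (div_pos hx₂ hx).le
    (div_pos hy₂ hy).le hab
  have hsum : a * (x₁ / (x₁ + x₂)) + b * (y₁ / (y₁ + y₂)) +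
      (a * (x₂ / (x₁ + x₂)) + b * (y₂ / (y₁ + y₂))) = 1 := by
    field_simp; linear_combination (x₁ + x₂) * (y₁ + y₂) * hab
  rw [Real.div_rpow hx₁.le hx.le, Real.div_rpow hy₁.le hy.le] at h1
  rw [Real.div_rpow hx₂.le hx.le, Real.div_rpow hy₂.le hy.le] at h2
  have h3 : (x₁ ^ a * y₁ ^ b + x₂ ^ a * y₂ ^ b) / ((x₁ + x₂) ^ a * (y₁ + y₂) ^ b) ≤ 1 := by
    calc _ = x₁ ^ a / (x₁ + x₂) ^ a * (y₁ ^ b / (y₁ + y₂) ^ b) +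
        x₂ ^ a / (x₁ + x₂) ^ a * (y₂ ^ b / (y₁ + y₂) ^ b) := by
          field_simp
      _ ≤ _ := by linarith
  rwa [div_le_one (by positivity)] at h3

/-- The equality case of Hölder's inequality for two terms. -/
theorem two_term_holder_eq {x₁ x₂ y₁ y₂ a b : ℝ} (hx₁ : 0 < x₁) (hx₂ : 0 < x₂) (hy₁ : 0 < y₁)
    (hy₂ : 0 < y₂) (ha : 0 < a) (hb : 0 < b) (hab : a + b = 1)
    (heq : (x₁ + x₂) ^ a * (y₁ + y₂) ^ b ≤ x₁ ^ a * y₁ ^ b + x₂ ^ a * y₂ ^ b) :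
    x₁ / (x₁ + x₂) = y₁ / (y₁ + y₂) := by
  by_contra hne
  have hx : 0 < x₁ + x₂ := by positivity
  have hy : 0 < y₁ + y₂ := by positivity
  have h1 := rpow_mul_rpow_lt (div_pos hx₁ hx) (div_pos hy₁ hy) ha hb hab hne
  have h2 := Real.geom_mean_le_arith_mean2_weighted ha.le hb.le (div_pos hx₂ hx).le
    (div_pos hy₂ hy).le hab
  have hsum : a * (x₁ / (x₁ + x₂)) + b * (y₁ / (y₁ + y₂)) +
      (a * (x₂ / (x₁ + x₂)) + b * (y₂ / (y₁ + y₂))) = 1 := by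
    field_simp; linear_combination (x₁ + x₂) * (y₁ + y₂) * hab
  rw [Real.div_rpow hx₁.le hx.le, Real.div_rpow hy₁.le hy.le] at h1
  rw [Real.div_rpow hx₂.le hx.le, Real.div_rpow hy₂.le hy.le] at h2
  have h3 : (x₁ ^ a * y₁ ^ b + x₂ ^ a * y₂ ^ b) / ((x₁ + x₂) ^ a * (y₁ + y₂) ^ b) < 1 := by
    calc _ = x₁ ^ a / (x₁ + x₂) ^ a * (y₁ ^ b / (y₁ + y₂) ^ b) +
        x₂ ^ a / (x₁ + x₂) ^ a * (y₂ ^ b / (y₁ + y₂) ^ b) := by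
          field_simp
      _ < _ := by linarith
  rw [div_lt_one (by positivity)] at h3
  linarith

/-! ### Growth rates of the Lindeberg–Lyapunov family on the interval -/

/-- Positive eigenfunctions `h p` with eigenvalues `ρ p` of the operators
`u ↦ l ^ (-p) (w ^ p u(-l x) + u (σ x))` on `[-1, 1]`, with `w > 1` and `σ 0 = 1`. -/
structure EigenFamily (l : ℝ) (σ w ρ : ℝ → ℝ) (h : ℝ → ℝ → ℝ) : Prop where
  l_pos : 0 < l
  l_lt_one : l < 1
  mapsTo : MapsTo σ unitI unitI
  map_zero : σ 0 = 1
  one_lt : ∀ x ∈ unitI, 1 < w x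
  cont : ∀ p, 0 ≤ p → ContinuousOn (h p) unitI
  pos : ∀ p, 0 ≤ p → ∀ x ∈ unitI, 0 < h p x
  eigen : ∀ p, 0 ≤ p → ∀ x ∈ unitI,
    (w x / l) ^ p * h p (-l * x) + l⁻¹ ^ p * h p (σ x) = ρ p * h p x

namespace EigenFamily

variable {l : ℝ} {σ w ρ : ℝ → ℝ} {h : ℝ → ℝ → ℝ}

theorem zero_mem : (0 : ℝ) ∈ unitI := by simp

theorem one_mem : (1 : ℝ) ∈ unitI := by simp

theorem mapsTo_scale (E : EigenFamily l σ w ρ h) : MapsTo (fun x => -l * x) unitI unitI := by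
  intro x hx
  have h1 := E.l_pos
  have h2 := E.l_lt_one
  have h3 : |-l * x| ≤ 1 := by
    rw [abs_mul, abs_neg, abs_of_pos h1]
    exact mul_le_one₀ h2.le (abs_nonneg _) (abs_le.2 hx)
  exact abs_le.1 h3

theorem weight_pos (E : EigenFamily l σ w ρ h) {x : ℝ} (hx : x ∈ unitI) (p : ℝ) :
    0 < (w x / l) ^ p :=
  Real.rpow_pos_of_pos (div_pos (one_pos.trans (E.one_lt x hx)) E.l_pos) p

theorem inv_pos (E : EigenFamily l σ w ρ h) (p : ℝ) : 0 < l⁻¹ ^ p :=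
  Real.rpow_pos_of_pos (_root_.inv_pos.2 E.l_pos) p

/-- At `0` the linear branch returns `h p 0` itself, and the other branch adds the positive amount
`l⁻¹ ^ p * h p 1`. -/
theorem lower (E : EigenFamily l σ w ρ h) {p : ℝ} (hp : 0 ≤ p) : (w 0 / l) ^ p < ρ p := by
  have h0 := E.eigen p hp 0 zero_mem
  rw [mul_zero, E.map_zero] at h0
  have h1 := mul_pos (E.inv_pos p) (E.pos p hp 1 one_mem)
  have h2 := E.pos p hp 0 zero_mem
  by_contra! hle
  nlinarith [mul_le_mul_of_nonneg_right hle h2.le]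

theorem rho_pos (E : EigenFamily l σ w ρ h) {p : ℝ} (hp : 0 ≤ p) : 0 < ρ p :=
  (E.weight_pos zero_mem p).trans (E.lower hp)

/-- A positive lower bound `m` replaces continuity, which admits the discontinuous test function of
`upper`. -/
theorem le_of_super (E : EigenFamily l σ w ρ h) {p t m : ℝ} {u : ℝ → ℝ} (hp : 0 ≤ p) (ht : 0 ≤ t)
    (hm : 0 < m) (hu₀ : ∀ x ∈ unitI, m ≤ u x)
    (hu : ∀ x ∈ unitI, (w x / l) ^ p * u (-l * x) + l⁻¹ ^ p * u (σ x) ≤ t * u x) : ρ p ≤ t := by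
  obtain ⟨B, hB⟩ := exists_bound_of_continuousOn (E.cont p hp)
  have hB0 : 0 < B := (E.pos p hp 0 zero_mem).trans_le (hB 0 zero_mem)
  refine rate_le_of_sub_super (a₂ := fun _ => l⁻¹ ^ p) (M := B / m) E.mapsTo_scale E.mapsTo
    (fun x hx => (E.weight_pos hx p).le) (fun x _ => (E.inv_pos p).le) (E.rho_pos hp) ht hu
    (fun x hx => (E.eigen p hp x hx).ge) (by positivity) (fun x hx => ?_) zero_mem
    (E.pos p hp 0 zero_mem)
  calc h p x ≤ B := hB x hx
    _ = B / m * m := by field_simp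
    _ ≤ _ := by gcongr; exact hu₀ x hx

theorem le_of_sub (E : EigenFamily l σ w ρ h) {p s : ℝ} {v : ℝ → ℝ} (hp : 0 ≤ p) (hs : 0 < s)
    (hvc : ContinuousOn v unitI) (hv₀ : ∀ x ∈ unitI, 0 < v x)
    (hv : ∀ x ∈ unitI, s * v x ≤ (w x / l) ^ p * v (-l * x) + l⁻¹ ^ p * v (σ x)) : s ≤ ρ p := by
  obtain ⟨B, hB⟩ := exists_bound_of_continuousOn hvc
  obtain ⟨M, hM0, hM⟩ := exists_le_mul_of_pos hB (E.cont p hp) (E.pos p hp)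
  exact rate_le_of_sub_super (a₂ := fun _ => l⁻¹ ^ p) E.mapsTo_scale E.mapsTo
    (fun x hx => (E.weight_pos hx p).le) (fun x _ => (E.inv_pos p).le) hs (E.rho_pos hp).le
    (fun x hx => (E.eigen p hp x hx).le) hv hM0 hM zero_mem (hv₀ 0 zero_mem)

/-- Both branch factors `w x / l` and `l⁻¹` are at least `l⁻¹ > 1`, so `h p` is a subsolution for
the exponent `q` with rate `l⁻¹ ^ (q - p) * ρ p > ρ p`. -/
theorem strictMonoOn (E : EigenFamily l σ w ρ h) : StrictMonoOn ρ (Ici 0) := by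
  intro p hp q hq hpq
  have hp : 0 ≤ p := hp
  have hq : 0 ≤ q := hq
  have hl : 1 < l⁻¹ := (one_lt_inv₀ E.l_pos).2 E.l_lt_one
  have hc : 1 < l⁻¹ ^ (q - p) := Real.one_lt_rpow hl (by linarith)
  have hρ := E.rho_pos hp
  refine lt_of_lt_of_le (b := l⁻¹ ^ (q - p) * ρ p) (by nlinarith) ?_
  refine E.le_of_sub hq (by positivity) (E.cont p hp) (E.pos p hp) fun x hx => ?_
  have hw : l⁻¹ ^ (q - p) * (w x / l) ^ p ≤ (w x / l) ^ q := by
    have hwl : 0 < w x / l := div_pos (one_pos.trans (E.one_lt x hx)) E.l_pos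
    have hle : l⁻¹ ≤ w x / l := by
      rw [div_eq_mul_inv]
      exact le_mul_of_one_le_left (by positivity) (E.one_lt x hx).le
    calc _ ≤ (w x / l) ^ (q - p) * (w x / l) ^ p := by
          gcongr
      _ = _ := by rw [← Real.rpow_add hwl]; ring_nf
  have hi : l⁻¹ ^ (q - p) * l⁻¹ ^ p = l⁻¹ ^ q := by
    rw [← Real.rpow_add (by linarith)]; ring_nf
  have h1 := E.pos p hp _ (E.mapsTo_scale hx)
  calc l⁻¹ ^ (q - p) * ρ p * h p x
      = l⁻¹ ^ (q - p) * (w x / l) ^ p * h p (-l * x) + l⁻¹ ^ q * h p (σ x) := by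
        rw [mul_assoc, ← E.eigen p hp x hx, ← hi]; ring
    _ ≤ _ := by gcongr

/-- The Hölder interpolation of two eigenfunctions. -/
theorem interpolate (E : EigenFamily l σ w ρ h) {p q a b x : ℝ} (hp : 0 ≤ p) (hq : 0 ≤ q)
    (hx : x ∈ unitI) :
    (w x / l) ^ (a * p + b * q) * (h p (-l * x) ^ a * h q (-l * x) ^ b) +
      l⁻¹ ^ (a * p + b * q) * (h p (σ x) ^ a * h q (σ x) ^ b) =
    ((w x / l) ^ p * h p (-l * x)) ^ a * ((w x / l) ^ q * h q (-l * x)) ^ b +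
      (l⁻¹ ^ p * h p (σ x)) ^ a * (l⁻¹ ^ q * h q (σ x)) ^ b := by
  have hwl : 0 < w x / l := div_pos (one_pos.trans (E.one_lt x hx)) E.l_pos
  have hl : 0 < l⁻¹ := _root_.inv_pos.2 E.l_pos
  have e1 := E.pos p hp _ (E.mapsTo_scale hx)
  have e2 := E.pos q hq _ (E.mapsTo_scale hx)
  have e3 := E.pos p hp _ (E.mapsTo hx)
  have e4 := E.pos q hq _ (E.mapsTo hx)
  rw [Real.mul_rpow (by positivity) e1.le, Real.mul_rpow (by positivity) e2.le,
    Real.mul_rpow (by positivity) e3.le, Real.mul_rpow (by positivity) e4.le,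
    ← Real.rpow_mul hwl.le, ← Real.rpow_mul hwl.le, ← Real.rpow_mul hl.le, ← Real.rpow_mul hl.le,
    Real.rpow_add hwl, Real.rpow_add hl, mul_comm a p, mul_comm b q]
  ring

theorem interpolate_le (E : EigenFamily l σ w ρ h) {p q a b x : ℝ} (hp : 0 ≤ p) (hq : 0 ≤ q)
    (ha : 0 < a) (hb : 0 < b) (hab : a + b = 1) (hx : x ∈ unitI) :
    (w x / l) ^ (a * p + b * q) * (h p (-l * x) ^ a * h q (-l * x) ^ b) +
      l⁻¹ ^ (a * p + b * q) * (h p (σ x) ^ a * h q (σ x) ^ b) ≤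
    ρ p ^ a * ρ q ^ b * (h p x ^ a * h q x ^ b) := by
  have e1 := E.pos p hp _ (E.mapsTo_scale hx)
  have e2 := E.pos q hq _ (E.mapsTo_scale hx)
  have e3 := E.pos p hp _ (E.mapsTo hx)
  have e4 := E.pos q hq _ (E.mapsTo hx)
  have f1 := E.weight_pos hx p
  have f2 := E.weight_pos hx q
  have f3 := E.inv_pos p
  have f4 := E.inv_pos q
  rw [E.interpolate hp hq hx]
  refine (two_term_holder (by positivity) (by positivity) (by positivity) (by positivity)
    ha hb hab).trans (le_of_eq ?_)
  rw [E.eigen p hp x hx, E.eigen q hq x hx,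
    Real.mul_rpow (E.rho_pos hp).le (E.pos p hp x hx).le,
    Real.mul_rpow (E.rho_pos hq).le (E.pos q hq x hx).le]
  ring

theorem interpolate_pos (E : EigenFamily l σ w ρ h) {p q a b x : ℝ} (hp : 0 ≤ p) (hq : 0 ≤ q)
    (hx : x ∈ unitI) : 0 < h p x ^ a * h q x ^ b :=
  mul_pos (Real.rpow_pos_of_pos (E.pos p hp x hx) a) (Real.rpow_pos_of_pos (E.pos q hq x hx) b)

theorem interpolate_cont (E : EigenFamily l σ w ρ h) {p q : ℝ} (a b : ℝ) (hp : 0 ≤ p)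
    (hq : 0 ≤ q) : ContinuousOn (fun x => h p x ^ a * h q x ^ b) unitI :=
  ((E.cont p hp).rpow_const fun x hx => Or.inl (E.pos p hp x hx).ne').mul
    ((E.cont q hq).rpow_const fun x hx => Or.inl (E.pos q hq x hx).ne')

theorem rho_interpolate_le (E : EigenFamily l σ w ρ h) {p q a b : ℝ} (hp : 0 ≤ p) (hq : 0 ≤ q)
    (ha : 0 < a) (hb : 0 < b) (hab : a + b = 1) : ρ (a * p + b * q) ≤ ρ p ^ a * ρ q ^ b := by
  have h1 := E.rho_pos hp
  have h2 := E.rho_pos hq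
  obtain ⟨y, hy, hmin⟩ := isCompact_Icc.exists_isMinOn (s := unitI) ⟨0, by simp⟩
    (E.interpolate_cont a b hp hq)
  exact E.le_of_super (u := fun x => h p x ^ a * h q x ^ b) (by positivity) (by positivity)
    (E.interpolate_pos hp hq hy) (fun x hx => hmin hx)
    (fun x hx => E.interpolate_le hp hq ha hb hab hx)

/-- Equality in the interpolation inequality forces the normalized rates to agree: the set where
the eigenfunction is a maximal multiple of the interpolant is closed and invariant under
`x ↦ -l x`, so it contains `0`. -/
theorem eq_of_rho_interpolate (E : EigenFamily l σ w ρ h) {p q a b : ℝ} (hp : 0 ≤ p) (hq : 0 ≤ q)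
    (ha : 0 < a) (hb : 0 < b) (hab : a + b = 1)
    (heq : ρ p ^ a * ρ q ^ b ≤ ρ (a * p + b * q)) :
    (w 0 / l) ^ p / ρ p = (w 0 / l) ^ q / ρ q := by
  set r := a * p + b * q with hr_def
  have hr : 0 ≤ r := by positivity
  set u : ℝ → ℝ := fun x => h p x ^ a * h q x ^ b with hu_def
  have hupos : ∀ x ∈ unitI, 0 < u x := fun x hx => E.interpolate_pos hp hq hx
  have huc : ContinuousOn u unitI := E.interpolate_cont a b hp hq
  have hρ : ρ r = ρ p ^ a * ρ q ^ b := (E.rho_interpolate_le hp hq ha hb hab).antisymm heq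
  have hku : ∀ x ∈ unitI, (w x / l) ^ r * u (-l * x) + l⁻¹ ^ r * u (σ x) ≤ ρ r * u x := by
    intro x hx
    rw [hρ]
    exact E.interpolate_le hp hq ha hb hab hx
  have hquot : ContinuousOn (fun x => h r x / u x) unitI :=
    (E.cont r hr).div huc fun x hx => (hupos x hx).ne'
  obtain ⟨y, hy, hmax⟩ := isCompact_Icc.exists_isMaxOn (s := unitI) ⟨0, by simp⟩ hquot
  set M := h r y / u y with hM
  have hle : ∀ x ∈ unitI, h r x ≤ M * u x := fun x hx => (div_le_iff₀ (hupos x hx)).1 (hmax hx)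
  have hM0 : 0 < M := div_pos (E.pos r hr y hy) (hupos y hy)
  -- At a contact point, `h r ≤ M * u` on both branches and the supersolution property of `u`
  -- squeeze the eigenvalue equation, so every inequality is an equality there.
  have inv : ∀ x ∈ unitI, h r x = M * u x → h r (-l * x) = M * u (-l * x) ∧
      ρ r * u x ≤ (w x / l) ^ r * u (-l * x) + l⁻¹ ^ r * u (σ x) := by
    intro x hx hxe
    have g1 := E.eigen r hr x hx
    have g2 := hku x hx
    have g3 := mul_le_mul_of_nonneg_left (hle _ (E.mapsTo_scale hx)) (E.weight_pos hx r).le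
    have g4 := mul_le_mul_of_nonneg_left (hle _ (E.mapsTo hx)) (E.inv_pos r).le
    have g5 := mul_le_mul_of_nonneg_left g2 hM0.le
    have g6 : ρ r * h r x = M * (ρ r * u x) := by rw [hxe]; ring
    simp only at g3
    refine ⟨?_, ?_⟩
    · refine mul_left_cancel₀ (E.weight_pos hx r).ne' ?_
      linarith
    · refine le_of_mul_le_mul_left ?_ hM0
      linarith
  have hseq : ∀ n : ℕ, (-l) ^ n * y ∈ unitI ∧ h r ((-l) ^ n * y) = M * u ((-l) ^ n * y) := by
    intro n
    induction n with
    | zero => simpa using ⟨hy, by rw [hM]; field_simp [(hupos y hy).ne']⟩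
    | succ n ih =>
      have e : (-l) ^ (n + 1) * y = -l * ((-l) ^ n * y) := by rw [pow_succ]; ring
      rw [e]
      exact ⟨E.mapsTo_scale ih.1, (inv _ ih.1 ih.2).1⟩
  have hlim : Tendsto (fun n : ℕ => (-l) ^ n * y) atTop (𝓝[unitI] 0) := by
    refine tendsto_nhdsWithin_iff.2 ⟨?_, Eventually.of_forall fun n => (hseq n).1⟩
    have : Tendsto (fun n : ℕ => (-l) ^ n) atTop (𝓝 0) :=
      tendsto_pow_atTop_nhds_zero_of_abs_lt_one (by
        rw [abs_neg, abs_of_pos E.l_pos]; exact E.l_lt_one)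
    simpa using this.mul_const y
  have h0 : h r 0 = M * u 0 := by
    refine tendsto_nhds_unique (((E.cont r hr) 0 zero_mem).tendsto.comp hlim) ?_
    have := ((huc 0 zero_mem).tendsto.comp hlim).const_mul M
    refine this.congr fun n => ?_
    exact (hseq n).2.symm
  have hfin := (inv 0 zero_mem h0).2
  rw [hρ] at hfin
  have hx := zero_mem
  have e1 := E.pos p hp _ (E.mapsTo_scale hx)
  have e2 := E.pos q hq _ (E.mapsTo_scale hx)
  have e3 := E.pos p hp _ (E.mapsTo hx)
  have e4 := E.pos q hq _ (E.mapsTo hx)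
  have f1 := E.weight_pos hx p
  have f2 := E.weight_pos hx q
  have f3 := E.inv_pos p
  have f4 := E.inv_pos q
  have key : ρ p ^ a * ρ q ^ b * u 0 = ((w 0 / l) ^ p * h p (-l * 0) + l⁻¹ ^ p * h p (σ 0)) ^ a *
      ((w 0 / l) ^ q * h q (-l * 0) + l⁻¹ ^ q * h q (σ 0)) ^ b := by
    rw [E.eigen p hp 0 hx, E.eigen q hq 0 hx,
      Real.mul_rpow (E.rho_pos hp).le (E.pos p hp 0 hx).le,
      Real.mul_rpow (E.rho_pos hq).le (E.pos q hq 0 hx).le, hu_def]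
    ring
  have hint := E.interpolate (a := a) (b := b) hp hq hx
  rw [← hr_def] at hint
  rw [key, hu_def] at hfin
  simp only [hint] at hfin
  -- Because `-l * 0 = 0`, the share of the linear branch in the eigenvalue equation at `0` is
  -- exactly `(w 0 / l) ^ p / ρ p`, and likewise for `q`.
  have := two_term_holder_eq (by positivity) (by positivity) (by positivity) (by positivity)
    ha hb hab hfin
  rw [E.eigen p hp 0 hx, E.eigen q hq 0 hx, mul_zero] at this
  have e5 := E.pos p hp 0 hx
  have e6 := E.pos q hq 0 hx
  rw [mul_div_mul_right _ _ e5.ne', mul_div_mul_right _ _ e6.ne'] at this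
  exact this

/-- The weight is dominated, up to a multiplicative coboundary that dips near `0`, by its value
at `0`. -/
structure WeightDominated (l : ℝ) (σ w : ℝ → ℝ) (s δ θ : ℝ) : Prop where
  s_pos : 0 < s
  δ_pos : 0 < δ
  θ_pos : 0 < θ
  θ_lt : θ < 1
  image : ∀ x ∈ unitI, s < σ x
  near : ∀ x ∈ unitI, |x| ≤ s → w x * (1 + δ * (l * x) ^ 2) ≤ w 0 * (1 + δ * x ^ 2)
  far : ∀ x ∈ unitI, s < |x| → w x * (1 + δ) ≤ w 0 * (1 - θ) ^ 2

theorem upper (E : EigenFamily l σ w ρ h) {s δ θ : ℝ} (T : WeightDominated l σ w s δ θ)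
    {p : ℝ} (hp : 0 < p) : ρ p < (w 0 / l) ^ p + l⁻¹ ^ p := by
  have hl := E.l_pos
  have hli : 0 < l⁻¹ := _root_.inv_pos.2 hl
  have hw0 : 0 < w 0 := one_pos.trans (E.one_lt 0 zero_mem)
  have hθ0 := T.θ_pos
  have hθ1 : 0 < 1 - θ := sub_pos.2 T.θ_lt
  have hδ := T.δ_pos
  have hc : (1 - θ) ^ p < 1 := Real.rpow_lt_one hθ1.le (by linarith) hp
  have hc0 : 0 < (1 - θ) ^ p := Real.rpow_pos_of_pos hθ1 p
  have hA := E.weight_pos zero_mem p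
  have hL := E.inv_pos p
  -- The two entries are the rates for `|x| ≤ s` and `|x| > s`: in each zone exactly one branch
  -- gains the factor `(1 - θ) ^ p < 1`.
  set t := max ((w 0 / l) ^ p + l⁻¹ ^ p * (1 - θ) ^ p) ((w 0 / l) ^ p * (1 - θ) ^ p + l⁻¹ ^ p)
  have ht : t < (w 0 / l) ^ p + l⁻¹ ^ p := max_lt (by nlinarith) (by nlinarith)
  refine lt_of_le_of_lt ?_ ht
  classical
  -- The supersolution is `v ^ p`. The bump `1 + δ * x ^ 2` absorbs a weight that is not quite
  -- maximal at `0`; the drop to `1 - θ` lowers the `σ` branch, whose image lies beyond `s`.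
  set v : ℝ → ℝ := fun x => if |x| ≤ s then 1 + δ * x ^ 2 else 1 - θ with hv
  have hvlow : ∀ x, 1 - θ ≤ v x := by
    intro x
    simp only [hv]
    split_ifs
    · nlinarith [mul_nonneg hδ.le (sq_nonneg x)]
    · exact le_rfl
  have hvpos : ∀ x, 0 < v x := fun x => hθ1.trans_le (hvlow x)
  have hvup : ∀ x ∈ unitI, v x ≤ 1 + δ := by
    intro x hx
    simp only [hv]
    split_ifs
    · have : x ^ 2 ≤ 1 := (sq_le_one_iff_abs_le_one x).2 (abs_le.2 hx)
      nlinarith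
    · linarith
  have hσ : ∀ x ∈ unitI, v (σ x) = 1 - θ := by
    intro x hx
    simp only [hv]
    rw [if_neg]
    have := T.image x hx
    exact not_le.2 (this.trans_le (le_abs_self _))
  have hrp : ∀ x ∈ unitI, ∀ c, w x * v (-l * x) ≤ c * v x → 0 ≤ c →
      (w x / l) ^ p * v (-l * x) ^ p ≤ (c / l) ^ p * v x ^ p := by
    intro x hx c hcx hc0
    have hwx : 0 < w x := one_pos.trans (E.one_lt x hx)
    have := hvpos (-l * x)
    have := hvpos x
    rw [← Real.mul_rpow (by positivity) (by positivity),
      ← Real.mul_rpow (by positivity) (by positivity)]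
    refine Real.rpow_le_rpow (by positivity) ?_ hp.le
    rw [div_mul_eq_mul_div, div_mul_eq_mul_div]
    gcongr
  refine E.le_of_super (u := fun x => v x ^ p) (m := (1 - θ) ^ p) hp.le (by positivity) hc0
    (fun x _ => Real.rpow_le_rpow hθ1.le (hvlow x) hp.le) fun x hx => ?_
  have hvx := hvpos x
  have hvxp : 0 < v x ^ p := Real.rpow_pos_of_pos hvx p
  rw [hσ x hx]
  by_cases hxs : |x| ≤ s
  · have hv1 : v x = 1 + δ * x ^ 2 := by simp only [hv]; rw [if_pos hxs]
    have hv2 : v (-l * x) = 1 + δ * (l * x) ^ 2 := by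
      simp only [hv]
      rw [if_pos]
      · ring
      · rw [abs_mul, abs_neg, abs_of_pos hl]
        exact (mul_le_of_le_one_left (abs_nonneg _) E.l_lt_one.le).trans hxs
    have h1 := hrp x hx (w 0) (by rw [hv1, hv2]; exact T.near x hx hxs) hw0.le
    have h2 : 1 ≤ v x ^ p := Real.one_le_rpow
      (by rw [hv1]; nlinarith [mul_nonneg hδ.le (sq_nonneg x)]) hp.le
    calc _ ≤ (w 0 / l) ^ p * v x ^ p + l⁻¹ ^ p * (1 - θ) ^ p * v x ^ p := by
          have := le_mul_of_one_le_right (by positivity : 0 ≤ l⁻¹ ^ p * (1 - θ) ^ p) h2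
          linarith
      _ = ((w 0 / l) ^ p + l⁻¹ ^ p * (1 - θ) ^ p) * v x ^ p := by ring
      _ ≤ _ := by gcongr; exact le_max_left _ _
  · have hv1 : v x = 1 - θ := by simp only [hv]; rw [if_neg hxs]
    have hwx : 0 < w x := one_pos.trans (E.one_lt x hx)
    have h1 := hrp x hx (w 0 * (1 - θ)) (by
      rw [hv1]
      have := T.far x hx (not_le.1 hxs)
      have := mul_le_mul_of_nonneg_left (hvup _ (E.mapsTo_scale hx)) hwx.le
      nlinarith) (by positivity)
    have h2 : (w 0 * (1 - θ) / l) ^ p = (w 0 / l) ^ p * (1 - θ) ^ p := by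
      rw [← Real.mul_rpow (by positivity) hθ1.le]; congr 1; ring
    rw [h2] at h1
    calc _ ≤ (w 0 / l) ^ p * (1 - θ) ^ p * v x ^ p + l⁻¹ ^ p * v x ^ p := by
          rw [← hv1] at h1 ⊢; linarith
      _ = ((w 0 / l) ^ p * (1 - θ) ^ p + l⁻¹ ^ p) * v x ^ p := by ring
      _ ≤ _ := by gcongr; exact le_max_right _ _

/-! ### Strict convexity and monotonicity through the excess -/

/-- The excess of the logarithmic rate over its linear lower bound. -/
noncomputable def excess (l : ℝ) (w ρ : ℝ → ℝ) (p : ℝ) : ℝ := Real.log (ρ p) - p * Real.log (w 0 / l)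

theorem excess_pos (E : EigenFamily l σ w ρ h) {p : ℝ} (hp : 0 ≤ p) : 0 < excess l w ρ p := by
  have h1 := Real.log_lt_log (E.weight_pos zero_mem p) (E.lower hp)
  rw [Real.log_rpow (div_pos (one_pos.trans (E.one_lt 0 zero_mem)) E.l_pos)] at h1
  exact sub_pos.2 h1

theorem excess_interpolate_le (E : EigenFamily l σ w ρ h) {p q a b : ℝ} (hp : 0 ≤ p) (hq : 0 ≤ q)
    (ha : 0 < a) (hb : 0 < b) (hab : a + b = 1) :
    excess l w ρ (a * p + b * q) ≤ a * excess l w ρ p + b * excess l w ρ q := by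
  have h1 := E.rho_pos hp
  have h2 := E.rho_pos hq
  have h3 := E.rho_pos (p := a * p + b * q) (by positivity)
  have h4 := Real.log_le_log h3 (E.rho_interpolate_le hp hq ha hb hab)
  rw [Real.log_mul (by positivity) (by positivity), Real.log_rpow h1, Real.log_rpow h2] at h4
  unfold excess
  linarith

/-- This is `log y ≤ y - 1` applied to the upper bound divided by `(w 0 / l) ^ p`; as `w 0 > 1`, the
excess tends to `0`. -/
theorem excess_le (E : EigenFamily l σ w ρ h) {s δ θ : ℝ} (T : WeightDominated l σ w s δ θ)
    {p : ℝ} (hp : 0 < p) : excess l w ρ p ≤ (w 0)⁻¹ ^ p := by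
  have hl := E.l_pos
  have hw0 : 0 < w 0 := one_pos.trans (E.one_lt 0 zero_mem)
  have h1 := E.upper T hp
  have hA := E.weight_pos zero_mem p
  have hρ := E.rho_pos hp.le
  have h2 : ρ p / (w 0 / l) ^ p ≤ 1 + (w 0)⁻¹ ^ p := by
    rw [div_le_iff₀ hA]
    have : (w 0)⁻¹ ^ p * (w 0 / l) ^ p = l⁻¹ ^ p := by
      rw [← Real.mul_rpow (by positivity) (by positivity)]; congr 1; field_simp
    linarith
  have h3 := Real.log_le_sub_one_of_pos (div_pos hρ hA)
  rw [Real.log_div hρ.ne' hA.ne', Real.log_rpow (by positivity)] at h3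
  unfold excess
  linarith

/-- A convex function that fails to decrease from `p` to `q` stays at least its value at `q` from
there on; decay to `0` would then contradict positivity. -/
theorem excess_lt (E : EigenFamily l σ w ρ h) {s δ θ : ℝ} (T : WeightDominated l σ w s δ θ)
    {p q : ℝ} (hp : 0 ≤ p) (hpq : p < q) : excess l w ρ q < excess l w ρ p := by
  by_contra! hle
  have hq : 0 < q := hp.trans_lt hpq
  have hlarge : ∀ t, q < t → excess l w ρ q ≤ excess l w ρ t := by
    intro t ht
    have htp : 0 < t - p := by linarith
    have ha : 0 < (t - q) / (t - p) := div_pos (by linarith) htp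
    have hb : 0 < (q - p) / (t - p) := div_pos (by linarith) htp
    have hab : (t - q) / (t - p) + (q - p) / (t - p) = 1 := by field_simp; ring
    have h1 := E.excess_interpolate_le hp (hq.trans ht).le ha hb hab
    have h2 : (t - q) / (t - p) * p + (q - p) / (t - p) * t = q := by field_simp; ring
    rw [h2] at h1
    have h3 := mul_le_mul_of_nonneg_left hle ha.le
    have h4 : (t - q) / (t - p) * excess l w ρ q + (q - p) / (t - p) * excess l w ρ q =
      excess l w ρ q := by rw [← add_mul, hab, one_mul]
    refine le_of_mul_le_mul_left ?_ hb
    linarith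
  have hlim : Tendsto (fun t : ℝ => (w 0)⁻¹ ^ t) atTop (𝓝 0) :=
    tendsto_rpow_atTop_of_base_lt_one _
      (by have := one_pos.trans (E.one_lt 0 zero_mem)
          have := _root_.inv_pos.2 this
          linarith)
      (inv_lt_one_of_one_lt₀ (E.one_lt 0 zero_mem))
  have h0 : excess l w ρ q ≤ 0 := by
    refine ge_of_tendsto hlim ?_
    filter_upwards [eventually_gt_atTop q] with t ht
    exact (hlarge t ht).trans (E.excess_le T (hq.trans ht))
  exact absurd h0 (not_le.2 (E.excess_pos hq.le))

theorem strictConvexOn_log (E : EigenFamily l σ w ρ h) {s δ θ : ℝ}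
    (T : WeightDominated l σ w s δ θ) : StrictConvexOn ℝ (Ici 0) fun p => Real.log (ρ p) := by
  refine ⟨convex_Ici 0, ?_⟩
  intro p hp q hq hpq a b ha hb hab
  have hp : 0 ≤ p := hp
  have hq : 0 ≤ q := hq
  have h1 := E.rho_pos hp
  have h2 := E.rho_pos hq
  have hr : 0 ≤ a * p + b * q := by positivity
  have h3 := E.rho_pos hr
  simp only [smul_eq_mul]
  rw [← Real.log_rpow h1, ← Real.log_rpow h2, ← Real.log_mul (by positivity) (by positivity)]
  refine Real.log_lt_log h3 ?_
  by_contra! hle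
  have heq := E.eq_of_rho_interpolate hp hq ha hb hab hle
  have hwl : 0 < w 0 / l := div_pos (one_pos.trans (E.one_lt 0 zero_mem)) E.l_pos
  have hlog := congrArg Real.log heq
  rw [Real.log_div (E.weight_pos zero_mem p).ne' h1.ne',
    Real.log_div (E.weight_pos zero_mem q).ne' h2.ne', Real.log_rpow hwl, Real.log_rpow hwl] at hlog
  have hex : excess l w ρ p = excess l w ρ q := by unfold excess; linarith
  rcases lt_or_gt_of_ne hpq with hlt | hlt
  · exact absurd hex (E.excess_lt T hp hlt).ne'
  · exact absurd hex (E.excess_lt T hq hlt).ne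

/-- The quotient is the constant `log (w 0 / l)` plus `excess / p`, a positive decreasing function
divided by an increasing one. -/
theorem strictAntiOn_log_div (E : EigenFamily l σ w ρ h) {s δ θ : ℝ}
    (T : WeightDominated l σ w s δ θ) :
    StrictAntiOn (fun p => Real.log (ρ p) / p) (Ioi 0) := by
  intro p hp q hq hpq
  have hp : 0 < p := hp
  have hq : 0 < q := hq
  have h1 : ∀ t, 0 < t → Real.log (ρ t) / t = Real.log (w 0 / l) + excess l w ρ t / t := by
    intro t ht
    unfold excess
    field_simp
    ring
  simp only
  rw [h1 p hp, h1 q hq]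
  have h2 := E.excess_lt T hp.le hpq
  have h3 := E.excess_pos hq.le
  have : excess l w ρ q / q < excess l w ρ p / p := by
    rw [div_lt_div_iff₀ hq hp]
    nlinarith
  linarith

theorem lt_rpow_half (E : EigenFamily l σ w ρ h) {s δ θ : ℝ}
    (T : WeightDominated l σ w s δ θ) {p : ℝ} (hp : 2 < p) : ρ p < ρ 2 ^ (p / 2) := by
  have hp0 : 0 < p := by linarith
  have h1 := E.strictAntiOn_log_div T (mem_Ioi.2 two_pos) (mem_Ioi.2 hp0) hp
  simp only at h1
  have h2 := E.rho_pos (p := 2) (by norm_num)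
  have h3 := E.rho_pos hp0.le
  rw [← Real.log_lt_log_iff h3 (by positivity), Real.log_rpow h2]
  rw [div_lt_div_iff₀ hp0 two_pos] at h1
  linarith

end EigenFamily

end PeriodDoubling

namespace PeriodDoubling

open Filter Topology

/-! ### Weighted composition operators on `H^r` -/

variable {D : Set ℂ}

/-- A weighted branch: a weight `a` and a map `S` from `closure D` to `D`, both analytic on `D`,
continuous on `closure D` and real on the reals. -/
structure Branch (D : Set ℂ) (a S : ℂ → ℂ) : Prop where
  mapsTo : MapsTo S (closure D) D
  cont : ContinuousOn S (closure D)
  diff : DifferentiableOn ℂ S D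
  real : ∀ x : ℝ, (x : ℂ) ∈ D → (S x).im = 0
  weight_cont : ContinuousOn a (closure D)
  weight_diff : DifferentiableOn ℂ a D
  weight_real : ∀ x : ℝ, (x : ℂ) ∈ D → (a x).im = 0

theorem ofReal_re_of_im_eq_zero {z : ℂ} (hz : z.im = 0) : ((z.re : ℝ) : ℂ) = z :=
  Complex.ext (by simp) (by simp [hz])

theorem compactSpace_closure (hD : Bornology.IsBounded D) : CompactSpace (closure D) :=
  isCompact_iff_compactSpace.1 hD.isCompact_closure

theorem Hr.ofReal_realTrace (h : Hr D) {x : ℝ} (hx : (x : ℂ) ∈ D) :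
    ((realTrace (zeroExt h.1) x : ℝ) : ℂ) = zeroExt h.1 x :=
  ofReal_re_of_im_eq_zero (h.2.2 x hx)

theorem Hr.norm_zeroExt_le (h : Hr D) {z : ℂ} (hz : z ∈ closure D) : ‖zeroExt h.1 z‖ ≤ ‖h‖ := by
  rw [zeroExt_apply h.1 ⟨z, hz⟩]
  exact h.1.norm_coe_le_norm _

theorem Hr.ext_of_eqOn {h k : Hr D} (hk : EqOn (zeroExt h.1) (zeroExt k.1) D) : h = k := by
  apply Subtype.ext
  apply DFunLike.coe_injective
  refine Continuous.ext_on (s := {z : closure D | (z : ℂ) ∈ D}) ?_ h.1.continuous k.1.continuous ?_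
  · intro z
    rw [closure_subtype]
    have : Subtype.val '' {z : closure D | (z : ℂ) ∈ D} = D := by
      ext w
      constructor
      · rintro ⟨y, hy, rfl⟩; exact hy
      · intro hw; exact ⟨⟨w, subset_closure hw⟩, hw, rfl⟩
    rw [this]
    exact z.2
  · intro z hz
    have := hk hz
    rwa [zeroExt_of_mem _ hz, zeroExt_of_mem _ hz] at this

/-- Uniform limits of analytic functions are analytic (Weierstrass), and reality passes to pointwise
limits. -/
theorem isClosed_Hr (hO : IsOpen D) : IsClosed (Hr D : Set (closure D →ᵇ ℂ)) := by
  refine isClosed_of_closure_subset fun h hh => ?_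
  obtain ⟨u, hu, hlim⟩ := mem_closure_iff_seq_limit.1 hh
  have hunif := BoundedContinuousFunction.tendsto_iff_tendstoUniformly.1 hlim
  have hun : TendstoUniformlyOn (fun n => zeroExt (u n)) (zeroExt h) atTop D := by
    rw [Metric.tendstoUniformlyOn_iff]
    intro ε hε
    filter_upwards [Metric.tendstoUniformly_iff.1 hunif ε hε] with n hn z hz
    rw [zeroExt_of_mem _ hz, zeroExt_of_mem _ hz]
    exact hn _
  refine ⟨hun.tendstoLocallyUniformlyOn.differentiableOn
    (Eventually.of_forall fun n => (hu n).1) hO, fun x hx => ?_⟩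
  have h1 := (Complex.continuous_im.tendsto _).comp (hun.tendsto_at hx)
  exact tendsto_nhds_unique h1 (tendsto_const_nhds.congr fun n => ((hu n).2 x hx).symm)

theorem completeSpace_Hr (hO : IsOpen D) : CompleteSpace (Hr D) :=
  (isClosed_Hr hO).completeSpace_coe

namespace Branch

variable {a S : ℂ → ℂ}

/-- The image of a function under a weighted branch. -/
noncomputable def applyFun (hD : Bornology.IsBounded D) (B : Branch D a S) (h : closure D →ᵇ ℂ) :
    closure D →ᵇ ℂ :=
  haveI := compactSpace_closure hD
  BoundedContinuousFunction.mkOfCompact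
    ⟨fun z => a z * h ⟨S z, subset_closure (B.mapsTo z.2)⟩,
      (continuousOn_iff_continuous_domRestrict.1 B.weight_cont).mul
        (h.continuous.comp ((continuousOn_iff_continuous_domRestrict.1 B.cont).subtype_mk _))⟩

theorem applyFun_apply (hD : Bornology.IsBounded D) (B : Branch D a S) (h : closure D →ᵇ ℂ)
    (z : closure D) : B.applyFun hD h z = a z * h ⟨S z, subset_closure (B.mapsTo z.2)⟩ := rfl

theorem zeroExt_applyFun (hD : Bornology.IsBounded D) (B : Branch D a S) (h : closure D →ᵇ ℂ)
    {z : ℂ} (hz : z ∈ closure D) : zeroExt (B.applyFun hD h) z = a z * zeroExt h (S z) := by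
  rw [zeroExt_apply _ ⟨z, hz⟩, applyFun_apply, zeroExt_of_mem _ (B.mapsTo hz)]

theorem exists_weight_bound (hD : Bornology.IsBounded D) (B : Branch D a S) :
    ∃ C, 0 ≤ C ∧ ∀ z ∈ closure D, ‖a z‖ ≤ C := by
  obtain ⟨C, hC⟩ := hD.isCompact_closure.exists_bound_of_continuousOn B.weight_cont
  exact ⟨max C 0, le_max_right _ _, fun z hz => (hC z hz).trans (le_max_left _ _)⟩

theorem applyFun_mem (hD : Bornology.IsBounded D) (B : Branch D a S) {h : closure D →ᵇ ℂ}
    (hh : h ∈ Hr D) : B.applyFun hD h ∈ Hr D := by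
  refine ⟨?_, fun x hx => ?_⟩
  · have hS : MapsTo S D D := fun z hz => B.mapsTo (subset_closure hz)
    exact (B.weight_diff.mul (hh.1.comp B.diff hS)).congr fun z hz =>
      B.zeroExt_applyFun hD h (subset_closure hz)
  · rw [B.zeroExt_applyFun hD h (subset_closure hx), ← ofReal_re_of_im_eq_zero (B.real x hx),
      Complex.mul_im, B.weight_real x hx]
    have hm : (((S x).re : ℝ) : ℂ) ∈ D := by
      rw [ofReal_re_of_im_eq_zero (B.real x hx)]; exact B.mapsTo (subset_closure hx)
    rw [hh.2 _ hm]
    simp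

/-- The weighted composition operator `h ↦ a · (h ∘ S)` on `H^r`. -/
noncomputable def op (hD : Bornology.IsBounded D) (B : Branch D a S) : Hr D →L[ℝ] Hr D :=
  LinearMap.mkContinuous
    { toFun := fun h => ⟨B.applyFun hD h.1, B.applyFun_mem hD h.2⟩
      map_add' := fun h k => by
        apply Subtype.ext
        ext z
        simp [applyFun_apply, mul_add]
      map_smul' := fun c h => by
        apply Subtype.ext
        ext z
        simp [applyFun_apply]
        ring }
    (B.exists_weight_bound hD).choose
    (fun h => by
      obtain ⟨hC0, hC⟩ := (B.exists_weight_bound hD).choose_spec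
      refine (BoundedContinuousFunction.norm_le (by positivity)).2 fun z => ?_
      change ‖a z * h.1 ⟨S z, subset_closure (B.mapsTo z.2)⟩‖ ≤ _
      rw [norm_mul]
      exact mul_le_mul (hC z z.2) (h.1.norm_coe_le_norm _) (norm_nonneg _) hC0)

/-- Every `S z₀`, even for `z₀` on the boundary, has a ball inside `D`. There the unit ball of `H^r`
is uniformly Lipschitz, so its image is equicontinuous and Arzelà–Ascoli applies. -/
theorem isCompactOperator_op (hO : IsOpen D) (hD : Bornology.IsBounded D) (B : Branch D a S) :
    IsCompactOperator (B.op hD) := by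
  have := compactSpace_closure hD
  obtain ⟨C, hC0, hC⟩ := B.exists_weight_bound hD
  set A : Set (closure D →ᵇ ℂ) := (fun h : Hr D => B.applyFun hD h.1) '' Metric.closedBall 0 1
  have hA : IsCompact (closure A) := by
    refine BoundedContinuousFunction.arzela_ascoli (Metric.closedBall 0 C)
      (isCompact_closedBall _ _) A ?_ ?_
    · rintro _ z ⟨h, hh, rfl⟩
      rw [mem_closedBall_zero_iff] at hh ⊢
      rw [applyFun_apply, norm_mul]
      calc _ ≤ C * 1 := mul_le_mul (hC z z.2) ((h.1.norm_coe_le_norm _).trans hh)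
            (norm_nonneg _) hC0
        _ = C := mul_one C
    · intro z₀
      obtain ⟨r, hr, hball⟩ := Metric.isOpen_iff.1 hO _ (B.mapsTo z₀.2)
      have hac : Continuous fun z : closure D => a z :=
        continuousOn_iff_continuous_domRestrict.1 B.weight_cont
      have hSc : Continuous fun z : closure D => S z :=
        continuousOn_iff_continuous_domRestrict.1 B.cont
      refine Metric.equicontinuousAt_of_continuity_modulus
        (fun z : closure D => ‖a z - a z₀‖ + C * (3 / r * dist (S z) (S z₀))) ?_ _ ?_
      · have h1 : Continuous fun z : closure D =>
            ‖a z - a z₀‖ + C * (3 / r * dist (S z) (S z₀)) :=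
          (hac.sub continuous_const).norm.add
            (continuous_const.mul (continuous_const.mul (hSc.dist continuous_const)))
        have h2 := h1.tendsto z₀
        simpa using h2
      · have hnear : ∀ᶠ z : closure D in 𝓝 z₀, S z ∈ Metric.ball (S z₀) r :=
          hSc.continuousAt.eventually (Metric.ball_mem_nhds _ hr)
        filter_upwards [hnear] with z hz
        rintro ⟨_, h, hh, rfl⟩
        rw [mem_closedBall_zero_iff] at hh
        have hone : ∀ w ∈ closure D, ‖zeroExt h.1 w‖ ≤ 1 := fun w hw =>
          (Hr.norm_zeroExt_le h hw).trans hh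
        have hS0 := B.mapsTo z₀.2
        have hSz := B.mapsTo z.2
        -- The Schwarz lemma on the ball of radius `r`, where values of `h` differ by at most `2`.
        have hlip : dist (zeroExt h.1 (S z)) (zeroExt h.1 (S z₀)) ≤
            3 / r * dist (S z) (S z₀) := by
          refine Complex.dist_le_div_mul_dist_of_mapsTo_ball (h.2.1.mono hball) ?_ hz
          intro w hw
          rw [Metric.mem_closedBall, dist_eq_norm]
          have h1 := hone w (subset_closure (hball hw))
          have h2 := hone _ (subset_closure hS0)
          linarith [norm_sub_le (zeroExt h.1 w) (zeroExt h.1 (S z₀))]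
        have e : ∀ y : closure D, B.applyFun hD h.1 y = a y * zeroExt h.1 (S y) := fun y => by
          rw [applyFun_apply, zeroExt_of_mem _ (B.mapsTo y.2)]
        simp only [e]
        rw [dist_comm, dist_eq_norm]
        calc ‖a z * zeroExt h.1 (S z) - a z₀ * zeroExt h.1 (S z₀)‖
            = ‖(a z - a z₀) * zeroExt h.1 (S z₀) +
                a z * (zeroExt h.1 (S z) - zeroExt h.1 (S z₀))‖ := by congr 1; ring
          _ ≤ ‖a z - a z₀‖ * 1 + C * (3 / r * dist (S z) (S z₀)) := by
            refine (norm_add_le _ _).trans ?_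
            rw [norm_mul, norm_mul, ← dist_eq_norm (zeroExt h.1 (S z))]
            gcongr
            · exact hone _ (subset_closure hS0)
            · exact hC z z.2
          _ = _ := by ring
  refine (isCompactOperator_iff_image_closedBall_subset_compact _ one_pos).2
    ⟨Subtype.val ⁻¹' closure A,
      (isClosed_Hr hO).isClosedEmbedding_subtypeVal.isCompact_preimage hA, ?_⟩
  rintro _ ⟨h, hh, rfl⟩
  exact subset_closure ⟨h, hh, rfl⟩

end Branch

end PeriodDoubling

namespace PeriodDoubling

open Filter Topology

variable {D : Set ℂ}

/-! ### Restriction of elements of `H^r` to the real line -/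

/-- The real function given by the values of an element of `H^r` at real points. -/
noncomputable def Hr.trace (h : Hr D) (x : ℝ) : ℝ := realTrace (zeroExt h.1) x

theorem Hr.trace_sub (h k : Hr D) {x : ℝ} (hx : (x : ℂ) ∈ D) :
    Hr.trace (h - k) x = Hr.trace h x - Hr.trace k x := by
  simp [trace, realTrace, zeroExt_of_mem _ hx]

theorem Hr.trace_smul (c : ℝ) (h : Hr D) {x : ℝ} (hx : (x : ℂ) ∈ D) :
    Hr.trace (c • h) x = c * Hr.trace h x := by
  simp [trace, realTrace, zeroExt_of_mem _ hx]

theorem Hr.abs_trace_le (h : Hr D) {x : ℝ} (hx : (x : ℂ) ∈ D) : |Hr.trace h x| ≤ ‖h‖ :=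
  (Complex.abs_re_le_norm _).trans (Hr.norm_zeroExt_le h (subset_closure hx))

theorem Hr.continuousOn_trace (hI : ∀ x ∈ unitI, (x : ℂ) ∈ D) (h : Hr D) :
    ContinuousOn (Hr.trace h) unitI :=
  Complex.continuous_re.comp_continuousOn
    (h.2.1.continuousOn.comp Complex.continuous_ofReal.continuousOn hI)

/-- The constant function `1` as an element of `H^r`. -/
noncomputable def Hr.one (D : Set ℂ) : Hr D :=
  ⟨BoundedContinuousFunction.const _ 1, by
    refine ⟨(differentiableOn_const (1 : ℂ)).congr fun z hz => ?_, fun x hx => ?_⟩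
    · simp [zeroExt_of_mem _ hz]
    · simp [zeroExt_of_mem _ hx]⟩

theorem Hr.trace_one {x : ℝ} (hx : (x : ℂ) ∈ D) : Hr.trace (Hr.one D) x = 1 := by
  simp [trace, realTrace, zeroExt_of_mem _ hx, Hr.one]

/-- Identity theorem in `H^r`, along the orbit of a contraction of the line. -/
theorem Hr.eq_zero_of_orbit (hO : IsOpen D) (hC : IsPreconnected D) (h0 : (0 : ℂ) ∈ D) {m x : ℝ}
    (hm : |m| < 1) (hm0 : m ≠ 0) (hx : x ≠ 0) {h : Hr D}
    (hD : ∀ n : ℕ, ((m ^ n * x : ℝ) : ℂ) ∈ D) (hz : ∀ n : ℕ, Hr.trace h (m ^ n * x) = 0) : h = 0 := by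
  apply Hr.ext_of_eqOn
  have han : AnalyticOnNhd ℂ (zeroExt h.1) D := h.2.1.analyticOnNhd hO
  have hlim : Tendsto (fun n : ℕ => ((m ^ n * x : ℝ) : ℂ)) atTop (𝓝[≠] 0) := by
    refine tendsto_nhdsWithin_iff.2 ⟨?_, Eventually.of_forall fun n => ?_⟩
    · have h1 := (tendsto_pow_atTop_nhds_zero_of_abs_lt_one hm).mul_const x
      rw [zero_mul] at h1
      have h2 := (Complex.continuous_ofReal.tendsto 0).comp h1
      exact_mod_cast h2
    · simp [hm0, hx]
  have hfreq : ∃ᶠ z in 𝓝[≠] (0 : ℂ), zeroExt h.1 z = 0 := by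
    refine hlim.frequently (Frequently.of_forall fun n => ?_)
    rw [← Hr.ofReal_realTrace h (hD n)]
    exact_mod_cast hz n
  have := han.eqOn_zero_of_preconnected_of_frequently_eq_zero hC h0 hfreq
  intro z hz
  rw [this hz, zeroExt_of_mem _ hz]
  simp

/-! ### Compact operators and the complex spectral radius -/

/-- The Fredholm alternative at `c ≠ 0` for the compact operator `b • K - K * K`. -/
theorem isUnit_quadratic_of_injective {X : Type*} [NormedAddCommGroup X] [NormedSpace ℝ X]
    [CompleteSpace X] {K : X →L[ℝ] X} (hK : IsCompactOperator K) {b c : ℝ} (hc : c ≠ 0)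
    (hinj : ∀ x, K (K x) = b • K x - c • x → x = 0) :
    IsUnit (algebraMap ℝ (X →L[ℝ] X) c - b • K + K * K) := by
  have hcomp : IsCompactOperator (b • K - K * K : X →L[ℝ] X) :=
    (hK.smul b).sub (hK.comp_clm K)
  rcases hcomp.hasEigenvalue_or_mem_resolventSet hc with he | hr
  · obtain ⟨x, hx⟩ := he.exists_hasEigenvector
    have h1 : b • K x - K (K x) = c • x := hx.apply_eq_smul
    exact absurd (hinj x (by rw [← h1]; abel)) hx.2
  · have h1 : IsUnit (algebraMap ℝ (X →L[ℝ] X) c - (b • K - K * K)) := hr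
    rwa [← sub_add] at h1

theorem exists_sub_eq_of_injective {X : Type*} [NormedAddCommGroup X] [NormedSpace ℝ X]
    [CompleteSpace X] {K : X →L[ℝ] X} (hK : IsCompactOperator K) {s : ℝ} (hs : s ≠ 0)
    (hinj : ∀ x, K x = s • x → x = 0) (k : X) : ∃ h, s • h - K h = k := by
  rcases hK.hasEigenvalue_or_mem_resolventSet hs with he | hr
  · obtain ⟨x, hx⟩ := he.exists_hasEigenvector
    exact absurd (hinj x hx.apply_eq_smul) hx.2
  · have h1 : IsUnit (algebraMap ℝ (X →L[ℝ] X) s - K) := hr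
    obtain ⟨h, hh⟩ := (ContinuousLinearMap.isUnit_iff_bijective.1 h1).2 k
    exact ⟨h, by simpa [Algebra.algebraMap_eq_smul_one] using hh⟩

/-- The real part `ℂ ⊗ A → A` of the complexification of a real algebra. -/
noncomputable def tensorRe (A : Type*) [Ring A] [Algebra ℝ A] : ℂ ⊗[ℝ] A →ₗ[ℝ] A :=
  (TensorProduct.lid ℝ A).toLinearMap ∘ₗ LinearMap.rTensor A Complex.reLm

theorem tensorRe_tmul {A : Type*} [Ring A] [Algebra ℝ A] (z : ℂ) (a : A) :
    tensorRe A (z ⊗ₜ a) = z.re • a := by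
  simp [tensorRe]

theorem tensorRe_mul {A : Type*} [Ring A] [Algebra ℝ A] (y : ℂ ⊗[ℝ] A) (b : A) :
    tensorRe A (y * (1 : ℂ) ⊗ₜ[ℝ] b) = tensorRe A y * b := by
  induction y using TensorProduct.induction_on with
  | zero => simp
  | tmul z a => simp [tensorRe_tmul]
  | add x y hx hy => rw [add_mul, map_add, hx, hy, map_add, add_mul]

/-- The real part of a left inverse in the complexification is a left inverse in `A`. Hence a real
eigenvalue lies in the complex spectrum. -/
theorem exists_mul_eq_one_of_notMem_spectrum {A : Type*} [Ring A] [Algebra ℝ A] {a : A} {r : ℝ}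
    (hr : (r : ℂ) ∉ spectrum ℂ ((1 : ℂ) ⊗ₜ[ℝ] a)) : ∃ b, b * (algebraMap ℝ A r - a) = 1 := by
  rw [spectrum.notMem_iff] at hr
  have e : algebraMap ℂ (ℂ ⊗[ℝ] A) (r : ℂ) - (1 : ℂ) ⊗ₜ[ℝ] a =
      (1 : ℂ) ⊗ₜ[ℝ] (algebraMap ℝ A r - a) := by
    rw [TensorProduct.tmul_sub, Algebra.algebraMap_eq_smul_one (A := A), TensorProduct.tmul_smul,
      TensorProduct.smul_tmul', Algebra.TensorProduct.algebraMap_apply]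
    simp
  rw [e] at hr
  obtain ⟨y, hy⟩ := hr.exists_left_inv
  have h1 := congrArg (tensorRe A) hy
  rw [tensorRe_mul, Algebra.TensorProduct.one_def, tensorRe_tmul, Complex.one_re, one_smul] at h1
  exact ⟨_, h1⟩

/-- The real quadratic factors over the complexification as `(μ - a)` times `(conj μ - a)`, and
commuting factors of a unit are units. Complex spectral points are thus excluded by real arguments.
-/
theorem notMem_spectrum_of_isUnit_quadratic {A : Type*} [Ring A] [Algebra ℝ A] {a : A} {μ : ℂ}
    (hu : IsUnit (algebraMap ℝ A (‖μ‖ ^ 2) - (2 * μ.re) • a + a * a)) :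
    μ ∉ spectrum ℂ ((1 : ℂ) ⊗ₜ[ℝ] a) := by
  rw [spectrum.notMem_iff]
  set c := (starRingEnd ℂ) μ
  have hnorm : μ * c = ((‖μ‖ ^ 2 : ℝ) : ℂ) := by
    rw [Complex.mul_conj, Complex.normSq_eq_norm_sq]
  have hre : μ + c = ((2 * μ.re : ℝ) : ℂ) := by rw [Complex.add_conj]
  have hr : ∀ r : ℝ, (r : ℂ) ⊗ₜ[ℝ] a = (1 : ℂ) ⊗ₜ[ℝ] (r • a) := fun r => by
    rw [TensorProduct.tmul_smul, TensorProduct.smul_tmul']; simp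
  have hr1 : ∀ r : ℝ, (r : ℂ) ⊗ₜ[ℝ] (1 : A) = (1 : ℂ) ⊗ₜ[ℝ] algebraMap ℝ A r := fun r => by
    rw [Algebra.algebraMap_eq_smul_one, TensorProduct.tmul_smul, TensorProduct.smul_tmul']; simp
  have hprod : ∀ ν κ : ℂ, ν * κ = ((‖μ‖ ^ 2 : ℝ) : ℂ) → ν + κ = ((2 * μ.re : ℝ) : ℂ) →
      (ν ⊗ₜ[ℝ] (1 : A) - (1 : ℂ) ⊗ₜ[ℝ] a) * (κ ⊗ₜ[ℝ] (1 : A) - (1 : ℂ) ⊗ₜ[ℝ] a) =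
      (1 : ℂ) ⊗ₜ[ℝ] (algebraMap ℝ A (‖μ‖ ^ 2) - (2 * μ.re) • a + a * a) := by
    intro ν κ h1 h2
    rw [sub_mul, mul_sub, mul_sub]
    simp only [Algebra.TensorProduct.tmul_mul_tmul, mul_one, one_mul]
    rw [TensorProduct.tmul_add, TensorProduct.tmul_sub, ← hr1, ← hr, ← h1, ← h2,
      TensorProduct.add_tmul]
    abel
  have hone : IsUnit ((1 : ℂ) ⊗ₜ[ℝ] (algebraMap ℝ A (‖μ‖ ^ 2) - (2 * μ.re) • a + a * a)) :=
    hu.map (Algebra.TensorProduct.includeRight : A →ₐ[ℝ] ℂ ⊗[ℝ] A)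
  have hcomm : Commute (μ ⊗ₜ[ℝ] (1 : A) - (1 : ℂ) ⊗ₜ[ℝ] a) (c ⊗ₜ[ℝ] (1 : A) - (1 : ℂ) ⊗ₜ[ℝ] a) := by
    rw [Commute, SemiconjBy, hprod μ c hnorm hre,
      hprod c μ (by rw [mul_comm, hnorm]) (by rw [add_comm, hre])]
  have hfin := (hcomm.isUnit_mul_iff.1 (by rw [hprod μ c hnorm hre]; exact hone)).1
  simpa [Algebra.TensorProduct.algebraMap_apply] using hfin

/-- If `r > 0` is an eigenvalue of a compact operator `K` and `K² - 2 re μ K + |μ|²` is injective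
for `|μ| > r`, then `r` is the spectral radius. -/
theorem opSpectralRadius_eq {X : Type*} [NormedAddCommGroup X] [NormedSpace ℝ X] [CompleteSpace X]
    {K : X →L[ℝ] X} (hcomp : IsCompactOperator K) {r : ℝ} (hr : 0 < r) {h : X} (hh : h ≠ 0)
    (hK : K h = r • h)
    (hq : ∀ μ : ℂ, r < ‖μ‖ → ∀ x, K (K x) = (2 * μ.re) • K x - (‖μ‖ ^ 2) • x → x = 0) :
    opSpectralRadius K = r := by
  have hmem : (r : ℂ) ∈ spectrum ℂ ((1 : ℂ) ⊗ₜ[ℝ] K) := by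
    by_contra hnot
    obtain ⟨b, hb⟩ := exists_mul_eq_one_of_notMem_spectrum hnot
    have h2 := congrArg (fun T : X →L[ℝ] X => T h) hb
    simp [Algebra.algebraMap_eq_smul_one, hK] at h2
    exact hh h2.symm
  have : spectralRadius ℂ ((1 : ℂ) ⊗ₜ[ℝ] K) = ENNReal.ofReal r := by
    apply le_antisymm
    · refine iSup₂_le fun μ hμ => ?_
      rw [← ENNReal.ofReal_coe_nnreal, coe_nnnorm]
      refine ENNReal.ofReal_le_ofReal ?_
      by_contra! hlt
      exact notMem_spectrum_of_isUnit_quadratic (isUnit_quadratic_of_injective hcomp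
        (pow_pos (hr.trans hlt) 2).ne' (hq μ hlt)) hμ
    · refine le_trans (le_of_eq ?_) (le_iSup₂ (α := ENNReal)
        (f := fun μ (_ : μ ∈ spectrum ℂ ((1 : ℂ) ⊗ₜ[ℝ] K)) => (‖μ‖₊ : ENNReal)) _ hmem)
      rw [← ENNReal.ofReal_coe_nnreal, coe_nnnorm, Complex.norm_real,
        Real.norm_of_nonneg hr.le]
  rw [opSpectralRadius, this, ENNReal.toReal_ofReal hr.le]

/-- A bounded sequence of approximate eigenvectors of a compact operator yields an eigenvector that
is a limit of a subsequence. -/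
theorem exists_eigenvector_of_approx {X : Type*} [NormedAddCommGroup X] [NormedSpace ℝ X]
    {K : X →L[ℝ] X} (hK : IsCompactOperator K) {R : ℝ} (hR : 0 < R) {e : ℕ → X}
    (he : ∀ n, ‖e n‖ = 1) (hlim : Tendsto (fun n => R • e n - K (e n)) atTop (𝓝 0)) :
    ∃ y, y ≠ 0 ∧ K y = R • y ∧ ∃ φ : ℕ → ℕ, Tendsto (fun n => R • e (φ n)) atTop (𝓝 y) := by
  obtain ⟨C, hC, hCsub⟩ := hK.image_closedBall_subset_compact 1
  obtain ⟨y, -, φ, hφ, hy⟩ := hC.tendsto_subseq fun n => hCsub ⟨e n, by simp [he n], rfl⟩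
  have hy' : Tendsto (fun n => K (e (φ n))) atTop (𝓝 y) := hy
  have hconv : Tendsto (fun n => R • e (φ n)) atTop (𝓝 y) := by
    have h3 := (hlim.comp hφ.tendsto_atTop).add hy'
    rw [zero_add] at h3
    exact h3.congr fun n => by simp
  have hnorm : ‖y‖ = R := by
    refine tendsto_nhds_unique hconv.norm (tendsto_const_nhds.congr fun n => ?_)
    rw [norm_smul, he, mul_one, Real.norm_of_nonneg hR.le]
  refine ⟨y, by rw [← norm_pos_iff, hnorm]; exact hR, ?_, φ, hconv⟩
  have h1 : Tendsto (fun n => K (R • e (φ n))) atTop (𝓝 (K y)) := (K.continuous.tendsto y).comp hconv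
  refine tendsto_nhds_unique h1 ?_
  simp only [map_smul]
  exact hy'.const_smul R

/-! ### Two-branch transfer operators on `H^r` -/

/-- A pair of weighted branches, the first one linear with ratio `m`, that preserves `[-1, 1]` and
has positive weights there. -/
structure BranchPair (D : Set ℂ) (m : ℝ) (a₁ a₂ S : ℂ → ℂ) : Prop where
  isOpen : IsOpen D
  isPreconnected : IsPreconnected D
  isBounded : Bornology.IsBounded D
  interval_subset : ∀ x ∈ unitI, (x : ℂ) ∈ D
  ratio_ne : m ≠ 0
  ratio_lt : |m| < 1
  left : Branch D a₁ (fun z => (m : ℂ) * z)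
  right : Branch D a₂ S
  mapsTo : MapsTo (realTrace S) unitI unitI
  map_zero : realTrace S 0 = 1
  left_pos : ∀ x ∈ unitI, 0 < realTrace a₁ x
  right_pos : ∀ x ∈ unitI, 0 < realTrace a₂ x

namespace BranchPair

variable {m : ℝ} {a₁ a₂ S : ℂ → ℂ}

/-- The transfer operator of a pair of branches. -/
noncomputable def op (P : BranchPair D m a₁ a₂ S) : Hr D →L[ℝ] Hr D :=
  P.left.op P.isBounded + P.right.op P.isBounded

theorem isCompactOperator_op (P : BranchPair D m a₁ a₂ S) : IsCompactOperator P.op :=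
  (P.left.isCompactOperator_op P.isOpen P.isBounded).add
    (P.right.isCompactOperator_op P.isOpen P.isBounded)

theorem zeroExt_op (P : BranchPair D m a₁ a₂ S) (h : Hr D) {z : ℂ} (hz : z ∈ closure D) :
    zeroExt (P.op h).1 z = a₁ z * zeroExt h.1 (m * z) + a₂ z * zeroExt h.1 (S z) := by
  rw [← P.left.zeroExt_applyFun P.isBounded h.1 hz, ← P.right.zeroExt_applyFun P.isBounded h.1 hz,
    zeroExt_apply _ ⟨z, hz⟩, zeroExt_apply _ ⟨z, hz⟩, zeroExt_apply _ ⟨z, hz⟩]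
  rfl

theorem mapsTo_scale (P : BranchPair D m a₁ a₂ S) : MapsTo (fun x => m * x) unitI unitI := by
  intro x hx
  have h3 : |m * x| ≤ 1 := by
    rw [abs_mul]
    exact mul_le_one₀ P.ratio_lt.le (abs_nonneg _) (abs_le.2 hx)
  exact abs_le.1 h3

theorem trace_op (P : BranchPair D m a₁ a₂ S) (h : Hr D) {x : ℝ} (hx : x ∈ unitI) :
    Hr.trace (P.op h) x =
      realTrace a₁ x * Hr.trace h (m * x) + realTrace a₂ x * Hr.trace h (realTrace S x) := by
  have hxD := P.interval_subset x hx
  have e1 : ((realTrace a₁ x : ℝ) : ℂ) = a₁ x :=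
    ofReal_re_of_im_eq_zero (P.left.weight_real x hxD)
  have e2 : ((realTrace a₂ x : ℝ) : ℂ) = a₂ x :=
    ofReal_re_of_im_eq_zero (P.right.weight_real x hxD)
  have e3 : ((realTrace S x : ℝ) : ℂ) = S x := ofReal_re_of_im_eq_zero (P.right.real x hxD)
  have e4 := Hr.ofReal_realTrace h (P.interval_subset _ (P.mapsTo_scale hx))
  have e5 := Hr.ofReal_realTrace h (P.interval_subset _ (P.mapsTo hx))
  have e6 := Hr.ofReal_realTrace (P.op h) hxD
  rw [P.zeroExt_op h (subset_closure hxD), ← e1, ← e2, ← e3, ← Complex.ofReal_mul] at e6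
  rw [← e4, ← e5] at e6
  exact_mod_cast e6

/-! ### Optimal supersolution rate, positive eigenfunction and spectral radius -/

/-- `t` is the rate of a positive supersolution on the interval. -/
def IsSuperRate (m : ℝ) (a₁ a₂ S : ℂ → ℂ) (t : ℝ) : Prop :=
  0 < t ∧ ∃ (u : ℝ → ℝ) (c : ℝ), 0 < c ∧ (∀ x ∈ unitI, c ≤ u x) ∧
    ∀ x ∈ unitI, realTrace a₁ x * u (m * x) + realTrace a₂ x * u (realTrace S x) ≤ t * u x

theorem IsSuperRate.rate_le (P : BranchPair D m a₁ a₂ S) {t s B x₀ : ℝ} {v : ℝ → ℝ}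
    (ht : IsSuperRate m a₁ a₂ S t) (hs : 0 < s) (hvB : ∀ x ∈ unitI, v x ≤ B)
    (hv : ∀ x ∈ unitI, s * v x ≤ realTrace a₁ x * v (m * x) + realTrace a₂ x * v (realTrace S x))
    (hx₀ : x₀ ∈ unitI) (h0 : 0 < v x₀) : s ≤ t := by
  obtain ⟨ht0, u, c, hc, hcu, hu⟩ := ht
  have hB : 0 < B := h0.trans_le (hvB x₀ hx₀)
  refine rate_le_of_sub_super (M := B / c) P.mapsTo_scale P.mapsTo (fun x hx => (P.left_pos x hx).le)
    (fun x hx => (P.right_pos x hx).le) hs ht0.le hu hv (by positivity) (fun x hx => ?_) hx₀ h0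
  calc v x ≤ B := hvB x hx
    _ = B / c * c := by field_simp
    _ ≤ _ := by gcongr; exact hcu x hx

/-- By the triangle inequality `‖v‖` is a subsolution with rate `‖μ‖ > t`, so comparison leaves only
`v = 0`. -/
theorem IsSuperRate.eq_zero (P : BranchPair D m a₁ a₂ S) {t B : ℝ} {μ : ℂ} {v : ℝ → ℂ}
    (ht : IsSuperRate m a₁ a₂ S t) (hμ : t < ‖μ‖) (hvB : ∀ x ∈ unitI, ‖v x‖ ≤ B)
    (hv : ∀ x ∈ unitI,
      (realTrace a₁ x : ℂ) * v (m * x) + (realTrace a₂ x : ℂ) * v (realTrace S x) = μ * v x) :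
    ∀ x ∈ unitI, v x = 0 := by
  intro x hx
  by_contra hne
  refine absurd (ht.rate_le P (ht.1.trans hμ) (v := fun x => ‖v x‖) hvB (fun y hy => ?_) hx
    (norm_pos_iff.2 hne)) (not_le.2 hμ)
  rw [← norm_mul, ← hv y hy]
  refine (norm_add_le _ _).trans (le_of_eq ?_)
  rw [norm_mul, norm_mul, Complex.norm_real, Complex.norm_real, Real.norm_of_nonneg
    (P.left_pos y hy).le, Real.norm_of_nonneg (P.right_pos y hy).le]

theorem eq_zero_of_trace (P : BranchPair D m a₁ a₂ S) {h : Hr D}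
    (hz : ∀ x ∈ unitI, Hr.trace h x = 0) : h = 0 := by
  have key : ∀ n : ℕ, m ^ n * 1 ∈ unitI := by
    intro n
    rw [mul_one]
    refine abs_le.1 ?_
    rw [abs_pow]
    exact pow_le_one₀ (abs_nonneg _) P.ratio_lt.le
  exact Hr.eq_zero_of_orbit P.isOpen P.isPreconnected
    (by simpa using P.interval_subset 0 EigenFamily.zero_mem) P.ratio_lt P.ratio_ne one_ne_zero
    (fun n => P.interval_subset _ (key n)) (fun n => hz _ (key n))

/-- Beyond a super-rate, the real quadratic polynomial of the operator with roots `μ` and its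
conjugate is injective. -/
theorem IsSuperRate.quadratic_injective (P : BranchPair D m a₁ a₂ S) {t : ℝ} {μ : ℂ}
    (ht : IsSuperRate m a₁ a₂ S t) (hμ : t < ‖μ‖) {h : Hr D}
    (hq : P.op (P.op h) = (2 * μ.re) • P.op h - (‖μ‖ ^ 2) • h) : h = 0 := by
  have hD := P.interval_subset
  have hnorm : (starRingEnd ℂ) μ * μ = ((‖μ‖ ^ 2 : ℝ) : ℂ) := by
    rw [mul_comm, Complex.mul_conj, Complex.normSq_eq_norm_sq]
  have hre : (starRingEnd ℂ) μ + μ = ((2 * μ.re : ℝ) : ℂ) := by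
    rw [add_comm, Complex.add_conj]
  have htr : ∀ x ∈ unitI, Hr.trace (P.op (P.op h)) x =
      2 * μ.re * Hr.trace (P.op h) x - ‖μ‖ ^ 2 * Hr.trace h x := by
    intro x hx
    rw [hq, Hr.trace_sub _ _ (hD x hx), Hr.trace_smul _ _ (hD x hx), Hr.trace_smul _ _ (hD x hx)]
  -- The function `conj μ * h - K h` is an eigenfunction for `μ`, hence vanishes; then `h` is an
  -- eigenfunction for `conj μ` and vanishes too.
  have h1 := ht.eq_zero P hμ
    (v := fun x => (starRingEnd ℂ) μ * (Hr.trace h x : ℂ) - (Hr.trace (P.op h) x : ℂ))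
    (B := ‖μ‖ * ‖h‖ + ‖P.op h‖)
    (fun x hx => by
      refine (norm_sub_le _ _).trans ?_
      rw [norm_mul, Complex.norm_real, Complex.norm_real, RCLike.norm_conj]
      have := Hr.abs_trace_le h (hD x hx)
      have := Hr.abs_trace_le (P.op h) (hD x hx)
      simp only [Real.norm_eq_abs]
      gcongr)
    (fun x hx => by
      have e1 : (Hr.trace (P.op h) x : ℂ) = _ := congrArg Complex.ofReal (P.trace_op h hx)
      have e2 : (Hr.trace (P.op (P.op h)) x : ℂ) = _ :=
        congrArg Complex.ofReal (P.trace_op (P.op h) hx)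
      rw [htr x hx] at e2
      push_cast at e1 e2 hnorm hre
      linear_combination (-(starRingEnd ℂ) μ) * e1 + e2 + (Hr.trace (P.op h) x : ℂ) * hre
        - (Hr.trace h x : ℂ) * hnorm)
  refine P.eq_zero_of_trace fun x hx => ?_
  have h2 := ht.eq_zero P (μ := (starRingEnd ℂ) μ) (by rwa [RCLike.norm_conj])
    (v := fun x => (Hr.trace h x : ℂ)) (B := ‖h‖)
    (fun x hx => by rw [Complex.norm_real]; exact Hr.abs_trace_le h (hD x hx))
    (fun x hx => by
      have e1 : (Hr.trace (P.op h) x : ℂ) = _ := congrArg Complex.ofReal (P.trace_op h hx)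
      have e2 := h1 x hx
      push_cast at e1
      linear_combination -e1 - e2)
    x hx
  exact_mod_cast h2

theorem IsSuperRate.exists_resolvent (P : BranchPair D m a₁ a₂ S) {t s : ℝ}
    (ht : IsSuperRate m a₁ a₂ S t) (hs : t < s) (k : Hr D) : ∃ h : Hr D, s • h - P.op h = k := by
  have := completeSpace_Hr P.isOpen
  have hs0 : 0 < s := ht.1.trans hs
  refine exists_sub_eq_of_injective P.isCompactOperator_op hs0.ne' (fun x h1 => ?_) k
  refine ht.quadratic_injective P (μ := (s : ℂ)) (h := x) ?_ ?_
  · rwa [Complex.norm_real, Real.norm_of_nonneg hs0.le]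
  · rw [h1, map_smul, h1, Complex.norm_real, Real.norm_of_nonneg hs0.le, Complex.ofReal_re]
    module

theorem exists_isSuperRate (P : BranchPair D m a₁ a₂ S) : ∃ t, IsSuperRate m a₁ a₂ S t := by
  have hc : ∀ {a T : ℂ → ℂ}, Branch D a T → ContinuousOn (realTrace a) unitI := fun B =>
    Complex.continuous_re.comp_continuousOn
      (B.weight_cont.comp Complex.continuous_ofReal.continuousOn
        fun x hx => subset_closure (P.interval_subset x hx))
  obtain ⟨B₁, h₁⟩ := exists_bound_of_continuousOn (hc P.left)
  obtain ⟨B₂, h₂⟩ := exists_bound_of_continuousOn (hc P.right)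
  have p1 := (P.left_pos 0 EigenFamily.zero_mem).trans_le (h₁ 0 EigenFamily.zero_mem)
  have p2 := (P.right_pos 0 EigenFamily.zero_mem).trans_le (h₂ 0 EigenFamily.zero_mem)
  exact ⟨B₁ + B₂, by positivity, fun _ => 1, 1, one_pos, fun _ _ => le_rfl, fun x hx => by
    have := h₁ x hx
    have := h₂ x hx
    simp only [mul_one]
    linarith⟩

theorem IsSuperRate.weight_le (P : BranchPair D m a₁ a₂ S) {t : ℝ}
    (ht : IsSuperRate m a₁ a₂ S t) : realTrace a₁ 0 ≤ t := by
  obtain ⟨_, u, c, hc, hcu, hu⟩ := ht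
  have h0 := hu 0 EigenFamily.zero_mem
  rw [mul_zero] at h0
  have h1 := mul_pos (P.right_pos 0 EigenFamily.zero_mem)
    (hc.trans_le (hcu _ (P.mapsTo EigenFamily.zero_mem)))
  exact le_of_mul_le_mul_right (by linarith) (hc.trans_le (hcu 0 EigenFamily.zero_mem))

/-- The optimal rate of a positive supersolution on the interval. -/
noncomputable def rate (m : ℝ) (a₁ a₂ S : ℂ → ℂ) : ℝ := sInf {t | IsSuperRate m a₁ a₂ S t}

theorem bddBelow (P : BranchPair D m a₁ a₂ S) : BddBelow {t | IsSuperRate m a₁ a₂ S t} :=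
  ⟨_, fun _ ht => IsSuperRate.weight_le P ht⟩

theorem rate_pos (P : BranchPair D m a₁ a₂ S) : 0 < rate m a₁ a₂ S :=
  (P.left_pos 0 EigenFamily.zero_mem).trans_le
    (le_csInf P.exists_isSuperRate fun _ ht => IsSuperRate.weight_le P ht)

theorem exists_isSuperRate_lt (P : BranchPair D m a₁ a₂ S) {s : ℝ} (hs : rate m a₁ a₂ S < s) :
    ∃ t, IsSuperRate m a₁ a₂ S t ∧ t < s :=
  exists_lt_of_csInf_lt P.exists_isSuperRate hs

/-- Above the optimal rate, the resolvent maps `1` to a positive function of large norm. -/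
theorem exists_resolvent_one (P : BranchPair D m a₁ a₂ S) {s : ℝ} (hs : rate m a₁ a₂ S < s) :
    ∃ h : Hr D, s • h - P.op h = Hr.one D ∧ (∀ x ∈ unitI, 0 ≤ Hr.trace h x) ∧ 0 < ‖h‖ ∧
      ‖h‖⁻¹ ≤ s - rate m a₁ a₂ S := by
  obtain ⟨t, ht, hts⟩ := P.exists_isSuperRate_lt hs
  have hs0 : 0 < s := ht.1.trans hts
  obtain ⟨h, hh⟩ := ht.exists_resolvent P hts (Hr.one D)
  have hD := P.interval_subset
  have htr : ∀ x ∈ unitI, realTrace a₁ x * Hr.trace h (m * x) +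
      realTrace a₂ x * Hr.trace h (realTrace S x) = s * Hr.trace h x - 1 := by
    intro x hx
    have e := congrArg (fun k : Hr D => Hr.trace k x) hh
    simp only [Hr.trace_sub _ _ (hD x hx), Hr.trace_smul _ _ (hD x hx), Hr.trace_one (hD x hx),
      P.trace_op h hx] at e
    linarith
  have hnn : ∀ x ∈ unitI, 0 ≤ Hr.trace h x := by
    intro x hx
    by_contra! hneg
    -- The negative part of the resolvent is a subsolution with rate `s > t`.
    refine absurd (ht.rate_le P hs0 (v := fun x => max (-Hr.trace h x) 0) (B := ‖h‖)
      (fun y hy => max_le ((neg_le_abs _).trans (Hr.abs_trace_le h (hD y hy))) (norm_nonneg _))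
      (fun y hy => ?_) hx (lt_max_of_lt_left (by linarith))) (not_le.2 hts)
    have p1 := P.left_pos y hy
    have p2 := P.right_pos y hy
    rw [mul_max_of_nonneg _ _ hs0.le, mul_zero]
    refine max_le ?_ (by positivity)
    have q1 := mul_le_mul_of_nonneg_left (le_max_left (-Hr.trace h (m * y)) 0) p1.le
    have q2 := mul_le_mul_of_nonneg_left (le_max_left (-Hr.trace h (realTrace S y)) 0) p2.le
    have := htr y hy
    linarith
  have hge : ∀ x ∈ unitI, s⁻¹ ≤ Hr.trace h x := by
    intro x hx
    have p1 := mul_nonneg (P.left_pos x hx).le (hnn _ (P.mapsTo_scale hx))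
    have p2 := mul_nonneg (P.right_pos x hx).le (hnn _ (P.mapsTo hx))
    simp only at p1
    rw [inv_le_iff_one_le_mul₀' hs0]
    linarith [htr x hx]
  have h0 := EigenFamily.zero_mem
  have hle : ∀ x ∈ unitI, Hr.trace h x ≤ ‖h‖ := fun x hx =>
    (le_abs_self _).trans (Hr.abs_trace_le h (hD x hx))
  have hpos : 0 < ‖h‖ := ((_root_.inv_pos.2 hs0).trans_le (hge 0 h0)).trans_le (hle 0 h0)
  refine ⟨h, hh, hnn, hpos, ?_⟩
  -- Since `h ≤ ‖h‖`, the inhomogeneity `1` is at least `‖h‖⁻¹ * h`. So `h` is itself a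
  -- supersolution with rate `s - ‖h‖⁻¹`, which minimality of `rate` bounds from below.
  have hsup : ∀ x ∈ unitI, realTrace a₁ x * Hr.trace h (m * x) +
      realTrace a₂ x * Hr.trace h (realTrace S x) ≤ (s - ‖h‖⁻¹) * Hr.trace h x := by
    intro x hx
    rw [htr x hx, sub_mul]
    have : ‖h‖⁻¹ * Hr.trace h x ≤ 1 := by
      rw [inv_mul_le_iff₀ hpos, mul_one]; exact hle x hx
    linarith
  have hsr : 0 < s - ‖h‖⁻¹ := by
    have e := hsup 0 h0
    have p1 := mul_nonneg (P.left_pos 0 h0).le (hnn _ (P.mapsTo_scale h0))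
    have p2 := mul_pos (P.right_pos 0 h0)
      ((_root_.inv_pos.2 hs0).trans_le (hge _ (P.mapsTo h0)))
    simp only at p1
    have p3 := (_root_.inv_pos.2 hs0).trans_le (hge 0 h0)
    exact pos_of_mul_pos_left (by linarith) p3.le
  have : rate m a₁ a₂ S ≤ s - ‖h‖⁻¹ := csInf_le P.bddBelow
    ⟨hsr, Hr.trace h, s⁻¹, _root_.inv_pos.2 hs0, hge, hsup⟩
  linarith

/-- The transfer operator has an eigenfunction that is positive on the interval. -/
theorem exists_eigenfunction (P : BranchPair D m a₁ a₂ S) :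
    ∃ h : Hr D, h ≠ 0 ∧ P.op h = rate m a₁ a₂ S • h ∧ ∀ x ∈ unitI, 0 < Hr.trace h x := by
  set R := rate m a₁ a₂ S with hR
  have hR0 : 0 < R := P.rate_pos
  have hD := P.interval_subset
  -- Along rates decreasing to `R` the resolvents of `1` blow up, so after normalization they are
  -- approximate eigenvectors.
  choose h hh hnn hpos hinv using fun n : ℕ =>
    P.exists_resolvent_one (s := R + 1 / ((n : ℝ) + 1)) (by
      have : 0 < 1 / ((n : ℝ) + 1) := by positivity
      linarith)
  set e : ℕ → Hr D := fun n => ‖h n‖⁻¹ • h n with he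
  have hen : ∀ n, ‖e n‖ = 1 := fun n => by
    rw [he]; simp only; rw [norm_smul, norm_inv, norm_norm, inv_mul_cancel₀ (hpos n).ne']
  have hlim0 : Tendsto (fun n : ℕ => 1 / ((n : ℝ) + 1)) atTop (𝓝 0) :=
    tendsto_one_div_add_atTop_nhds_zero_nat
  have hinv0 : Tendsto (fun n => ‖h n‖⁻¹) atTop (𝓝 0) :=
    squeeze_zero (fun n => (_root_.inv_pos.2 (hpos n)).le)
      (fun n => (hinv n).trans (by rw [← hR]; linarith)) hlim0
  have heq : ∀ n, R • e n - P.op (e n) = ‖h n‖⁻¹ • Hr.one D - (1 / ((n : ℝ) + 1)) • e n := by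
    intro n
    rw [← hh n, he]
    simp only [map_smul]
    module
  obtain ⟨y, hy0, hKy, φ, hconv⟩ := exists_eigenvector_of_approx P.isCompactOperator_op hR0 hen (by
    have h1 : Tendsto (fun n => ‖h n‖⁻¹ • Hr.one D) atTop (𝓝 0) := by
      have := hinv0.smul_const (Hr.one D)
      rwa [zero_smul] at this
    have h2 : Tendsto (fun n : ℕ => (1 / ((n : ℝ) + 1)) • e n) atTop (𝓝 0) := by
      rw [tendsto_zero_iff_norm_tendsto_zero]
      refine hlim0.congr fun n => ?_
      rw [norm_smul, hen, mul_one, Real.norm_of_nonneg (by positivity)]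
    have h3 := h1.sub h2
    rw [sub_zero] at h3
    exact h3.congr fun n => (heq n).symm)
  have hynn : ∀ x ∈ unitI, 0 ≤ Hr.trace y x := by
    intro x hx
    have hxD := hD x hx
    have h1 : Tendsto (fun n => Hr.trace (R • e (φ n)) x) atTop (𝓝 (Hr.trace y x)) := by
      have h2 : Tendsto (fun n => ‖R • e (φ n) - y‖) atTop (𝓝 0) :=
        tendsto_iff_norm_sub_tendsto_zero.1 hconv
      rw [tendsto_iff_norm_sub_tendsto_zero]
      refine squeeze_zero (fun _ => norm_nonneg _) (fun n => ?_) h2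
      rw [← Hr.trace_sub _ _ hxD]
      exact Hr.abs_trace_le _ hxD
    refine ge_of_tendsto' h1 fun n => ?_
    rw [Hr.trace_smul _ _ hxD, he]
    simp only
    rw [Hr.trace_smul _ _ hxD]
    have := hnn (φ n) x hx
    positivity
  -- A zero of a nonnegative eigenfunction passes to both branch images. From `x ≠ 0` the zeros
  -- accumulate at `0`, contradicting the identity theorem; a zero at `0` moves to `σ 0 = 1`.
  have hprop : ∀ x ∈ unitI, Hr.trace y x = 0 →
      Hr.trace y (m * x) = 0 ∧ Hr.trace y (realTrace S x) = 0 := by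
    intro x hx hx0
    have e1 := P.trace_op y hx
    rw [hKy, Hr.trace_smul _ _ (hD x hx), hx0, mul_zero] at e1
    have p1 := P.left_pos x hx
    have p2 := P.right_pos x hx
    have q1 : 0 ≤ Hr.trace y (m * x) := hynn _ (P.mapsTo_scale hx)
    have q2 := hynn _ (P.mapsTo hx)
    have r1 := mul_nonneg p1.le q1
    have r2 := mul_nonneg p2.le q2
    exact ⟨(mul_eq_zero.1 (by linarith : _ * Hr.trace y (m * x) = 0)).resolve_left p1.ne',
      (mul_eq_zero.1 (by linarith : _ * Hr.trace y (realTrace S x) = 0)).resolve_left p2.ne'⟩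
  have hnz : ∀ x ∈ unitI, x ≠ 0 → Hr.trace y x ≠ 0 := by
    intro x hx hxne hx0
    have key : ∀ n : ℕ, m ^ n * x ∈ unitI ∧ Hr.trace y (m ^ n * x) = 0 := by
      intro n
      induction n with
      | zero => simpa using ⟨hx, hx0⟩
      | succ n ih =>
        have e : m ^ (n + 1) * x = m * (m ^ n * x) := by rw [pow_succ]; ring
        rw [e]
        exact ⟨P.mapsTo_scale ih.1, (hprop _ ih.1 ih.2).1⟩
    exact hy0 (Hr.eq_zero_of_orbit P.isOpen P.isPreconnected
      (by simpa using hD 0 EigenFamily.zero_mem) P.ratio_lt P.ratio_ne hxne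
      (fun n => hD _ (key n).1) fun n => (key n).2)
  refine ⟨y, hy0, hKy, fun x hx => lt_of_le_of_ne (hynn x hx) fun hx0 => ?_⟩
  by_cases hxz : x = 0
  · have h1 := (hprop x hx hx0.symm).2
    rw [hxz, P.map_zero] at h1
    exact hnz 1 EigenFamily.one_mem one_ne_zero h1
  · exact hnz x hx hxz hx0.symm

theorem opSpectralRadius_op (P : BranchPair D m a₁ a₂ S) :
    opSpectralRadius P.op = rate m a₁ a₂ S := by
  obtain ⟨h, hh0, hh, -⟩ := P.exists_eigenfunction
  have := completeSpace_Hr P.isOpen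
  refine opSpectralRadius_eq P.isCompactOperator_op P.rate_pos hh0 hh fun μ hμ x hx => ?_
  obtain ⟨t, ht, htμ⟩ := P.exists_isSuperRate_lt hμ
  exact IsSuperRate.quadratic_injective P ht htμ hx

/-- The spectral radius is an eigenvalue with an eigenfunction that is positive and continuous on
the interval. -/
theorem exists_positive_eigenfunction (P : BranchPair D m a₁ a₂ S) :
    ∃ h : ℝ → ℝ, ContinuousOn h unitI ∧ (∀ x ∈ unitI, 0 < h x) ∧ ∀ x ∈ unitI,
      realTrace a₁ x * h (m * x) + realTrace a₂ x * h (realTrace S x) =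
        opSpectralRadius P.op * h x := by
  obtain ⟨h, -, hh, hpos⟩ := P.exists_eigenfunction
  refine ⟨Hr.trace h, Hr.continuousOn_trace P.interval_subset h, hpos, fun x hx => ?_⟩
  rw [← P.trace_op h hx, hh, P.opSpectralRadius_op, Hr.trace_smul _ _ (P.interval_subset x hx)]

end BranchPair

end PeriodDoubling

namespace PeriodDoubling

open Filter Topology

/-! ### Real traces of analytic maps -/

section RealTrace

variable {D : Set ℂ} {f : ℂ → ℂ}

theorem hasDerivAt_realTrace (hO : IsOpen D) (hf : DifferentiableOn ℂ f D) {x : ℝ}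
    (hx : (x : ℂ) ∈ D) : HasDerivAt (realTrace f) (realTrace (deriv f) x) x :=
  (hf.differentiableAt (hO.mem_nhds hx)).hasDerivAt.real_of_complex

theorem deriv_im_eq_zero (hO : IsOpen D) (hf : DifferentiableOn ℂ f D)
    (hr : ∀ x : ℝ, (x : ℂ) ∈ D → (f x).im = 0) {x : ℝ} (hx : (x : ℂ) ∈ D) :
    (deriv f x).im = 0 := by
  have h1 := (hf.differentiableAt (hO.mem_nhds hx)).hasDerivAt.comp_ofReal
  have h2 := Complex.imCLM.hasFDerivAt.comp_hasDerivAt x h1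
  have hev : (fun y : ℝ => Complex.imCLM (f y)) =ᶠ[𝓝 x] fun _ => 0 := by
    filter_upwards [Complex.continuous_ofReal.continuousAt.preimage_mem_nhds (hO.mem_nhds hx)]
      with y hy using hr y hy
  exact h2.unique ((hasDerivAt_const x (0 : ℝ)).congr_of_eventuallyEq hev)

end RealTrace

namespace Renormalizable

variable {φ : ℝ → ℝ}

theorem continuousOn (R : Renormalizable φ) : ContinuousOn φ unitI := R.analytic.continuousOn

theorem strictAntiOn (R : Renormalizable φ) : StrictAntiOn φ (Icc 0 1) := by
  refine strictAntiOn_of_deriv_neg (convex_Icc 0 1)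
    (R.continuousOn.mono (Icc_subset_Icc_left (by norm_num))) fun x hx => ?_
  rw [interior_Icc] at hx
  have := R.unimodal x ⟨by linarith [hx.1], hx.2.le⟩ hx.1.ne'
  exact neg_of_mul_neg_right this hx.1.le

theorem map_abs (R : Renormalizable φ) {x : ℝ} (hx : x ∈ unitI) : φ |x| = φ x := by
  rcases abs_choice x with h | h
  · rw [h]
  · rw [h, R.even x hx]

theorem lam_mem (R : Renormalizable φ) : φ 1 ∈ unitI := R.mapsTo (by simp)

/-- If `φ 1 ≥ 0`, then `φ (φ 1)` lies in `[0, 1]`, where `φ` decreases, so its image is at least `φ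
1`, against `image_lt`. -/
theorem lam_neg (R : Renormalizable φ) : φ 1 < 0 := by
  by_contra! hle
  have hl := R.lam_mem
  have hb := R.mapsTo hl
  have h1 := R.lam_lt
  rw [abs_of_nonneg hle] at h1
  have h3 := R.image_lt
  rw [abs_of_nonneg hle] at h3
  have h4 := R.strictAntiOn.antitoneOn (⟨by linarith, hb.2⟩ : φ (φ 1) ∈ Icc (0 : ℝ) 1)
    (⟨zero_le_one, le_rfl⟩ : (1 : ℝ) ∈ Icc (0 : ℝ) 1) hb.2
  linarith

theorem abs_lam (R : Renormalizable φ) : |φ 1| = -φ 1 := abs_of_neg R.lam_neg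

theorem abs_lam_lt_one (R : Renormalizable φ) : |φ 1| < 1 :=
  R.lam_lt.trans_le (R.mapsTo R.lam_mem).2

theorem scale_mem (R : Renormalizable φ) {x : ℝ} (hx : x ∈ unitI) : φ 1 * x ∈ unitI := by
  refine abs_le.1 ?_
  rw [abs_mul]
  exact mul_le_one₀ R.abs_lam_lt_one.le (abs_nonneg _) (abs_le.2 hx)

theorem le_scaled_image (R : Renormalizable φ) {x : ℝ} (hx : x ∈ unitI) :
    φ (φ 1) ≤ φ (φ 1 * x) := by
  rw [← R.map_abs (R.scale_mem hx), ← R.map_abs R.lam_mem]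
  refine R.strictAntiOn.antitoneOn ⟨abs_nonneg _, abs_le.2 (R.scale_mem hx)⟩
    ⟨abs_nonneg _, abs_le.2 R.lam_mem⟩ ?_
  rw [abs_mul]
  exact mul_le_of_le_one_right (abs_nonneg _) (abs_le.2 hx)

theorem scaled_image_lt_one (R : Renormalizable φ) {x : ℝ} (hx : x ∈ unitI) (hx0 : x ≠ 0) :
    φ (φ 1 * x) < 1 := by
  rw [← R.map_abs (R.scale_mem hx)]
  refine lt_of_lt_of_eq (R.strictAntiOn ⟨le_rfl, zero_le_one⟩
    ⟨abs_nonneg _, abs_le.2 (R.scale_mem hx)⟩ ?_) R.map_zero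
  exact abs_pos.2 (mul_ne_zero R.lam_neg.ne hx0)

end Renormalizable

/-! ### The Lindeberg–Lyapunov operators of an admissible map -/

/-- An interval renormalizable map, analytic on `D`, for which the Lindeberg–Lyapunov operators on
`H^r` are well defined. -/
structure Admissible (D : Set ℂ) (f : ℂ → ℂ) : Prop where
  isOpen : IsOpen D
  isPreconnected : IsPreconnected D
  isBounded : Bornology.IsBounded D
  interval_subset : ∀ x ∈ unitI, (x : ℂ) ∈ D
  diff : DifferentiableOn ℂ f D
  real : ∀ x : ℝ, (x : ℂ) ∈ D → (f x).im = 0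
  renormalizable : Renormalizable (realTrace f)
  scale : ∀ z ∈ closure D, (lam f : ℂ) * z ∈ D
  image : ∀ z ∈ closure D, f ((lam f : ℂ) * z) ∈ D
  weight : ∀ z ∈ closure D, -deriv f (f ((lam f : ℂ) * z)) ∈ Complex.slitPlane

/-- The interval map `x ↦ f (λ_f x)`. -/
noncomputable def scaledImage (f : ℂ → ℂ) (x : ℝ) : ℝ := realTrace f (lam f * x)

/-- The weight `x ↦ -f' (f (λ_f x))` on the interval. -/
noncomputable def intervalWeight (f : ℂ → ℂ) (x : ℝ) : ℝ := -realTrace (deriv f) (scaledImage f x)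

theorem lindebergLyapunov_eq {D : Set ℂ} {f : ℂ → ℂ} {p : ℝ} {K : Hr D →L[ℝ] Hr D}
    (hK : IsLindebergLyapunov D f p K) : lindebergLyapunov D f p = K := by
  have h : ∃ K, IsLindebergLyapunov D f p K := ⟨K, hK⟩
  rw [lindebergLyapunov, dif_pos h]
  exact h.choose_spec.unique hK

namespace Admissible

variable {D : Set ℂ} {f : ℂ → ℂ}

theorem lam_neg (G : Admissible D f) : lam f < 0 := G.renormalizable.lam_neg

theorem lam_abs_lt (G : Admissible D f) : |lam f| < 1 := G.renormalizable.abs_lam_lt_one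

theorem mapsTo (G : Admissible D f) : MapsTo (scaledImage f) unitI unitI := fun _ hx =>
  G.renormalizable.mapsTo (G.renormalizable.scale_mem hx)

theorem scaledImage_zero (f : ℂ → ℂ) (G : Admissible D f) : scaledImage f 0 = 1 := by
  rw [scaledImage, mul_zero, G.renormalizable.map_zero]

theorem ofReal_scaledImage (G : Admissible D f) {x : ℝ} (hx : (x : ℂ) ∈ D) :
    ((scaledImage f x : ℝ) : ℂ) = f ((lam f : ℂ) * x) := by
  have h1 : ((lam f * x : ℝ) : ℂ) ∈ D := by
    push_cast
    exact G.scale _ (subset_closure hx)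
  have := ofReal_re_of_im_eq_zero (G.real _ h1)
  push_cast at this
  rw [← this, scaledImage, realTrace]
  push_cast
  rfl

theorem ofReal_intervalWeight (G : Admissible D f) {x : ℝ} (hx : (x : ℂ) ∈ D) :
    ((intervalWeight f x : ℝ) : ℂ) = -deriv f (f ((lam f : ℂ) * x)) := by
  have h1 : ((scaledImage f x : ℝ) : ℂ) ∈ D := by
    rw [G.ofReal_scaledImage hx]
    exact G.image _ (subset_closure hx)
  have := ofReal_re_of_im_eq_zero (deriv_im_eq_zero G.isOpen G.diff G.real h1)
  rw [← G.ofReal_scaledImage hx, ← this, intervalWeight, realTrace]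
  push_cast
  rfl

theorem intervalWeight_pos (G : Admissible D f) {x : ℝ} (hx : (x : ℂ) ∈ D) :
    0 < intervalWeight f x := by
  have h1 := G.weight x (subset_closure hx)
  rw [← G.ofReal_intervalWeight hx] at h1
  exact Complex.ofReal_mem_slitPlane.1 h1

theorem continuousOn_image (G : Admissible D f) :
    ContinuousOn (fun z => f ((lam f : ℂ) * z)) (closure D) :=
  G.diff.continuousOn.comp (by fun_prop) G.scale

theorem diff_image (G : Admissible D f) : DifferentiableOn ℂ (fun z => f ((lam f : ℂ) * z)) D :=
  G.diff.comp (by fun_prop) fun z hz => G.scale z (subset_closure hz)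

theorem continuousOn_weight (G : Admissible D f) :
    ContinuousOn (fun z => -deriv f (f ((lam f : ℂ) * z))) (closure D) :=
  ((G.diff.deriv G.isOpen).continuousOn.comp G.continuousOn_image G.image).neg

theorem diff_weight (G : Admissible D f) :
    DifferentiableOn ℂ (fun z => -deriv f (f ((lam f : ℂ) * z))) D :=
  ((G.diff.deriv G.isOpen).comp G.diff_image fun z hz => G.image z (subset_closure hz)).neg

/-- The weight of the linear branch of `𝒦_{f,p}`. -/
noncomputable def leftWeight (f : ℂ → ℂ) (p : ℝ) (z : ℂ) : ℂ :=
  (((-lam f) ^ p : ℝ) : ℂ)⁻¹ * (-deriv f (f ((lam f : ℂ) * z))) ^ (p : ℂ)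

theorem leftWeight_ofReal (G : Admissible D f) (p : ℝ) {x : ℝ} (hx : (x : ℂ) ∈ D) :
    leftWeight f p x = (((intervalWeight f x / -lam f) ^ p : ℝ) : ℂ) := by
  have h1 := G.intervalWeight_pos hx
  have h2 := G.lam_neg
  rw [leftWeight, ← G.ofReal_intervalWeight hx, ← Complex.ofReal_cpow h1.le,
    Real.div_rpow h1.le (by linarith), div_eq_inv_mul]
  push_cast
  rfl

theorem left (G : Admissible D f) (p : ℝ) :
    Branch D (leftWeight f p) (fun z => (lam f : ℂ) * z) where
  mapsTo := G.scale
  cont := by fun_prop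
  diff := by fun_prop
  real := fun x _ => by simp
  weight_cont := continuousOn_const.mul (G.continuousOn_weight.cpow continuousOn_const G.weight)
  weight_diff := (differentiableOn_const _).mul (G.diff_weight.cpow (differentiableOn_const _)
    fun z hz => G.weight z (subset_closure hz))
  weight_real := fun x hx => by rw [G.leftWeight_ofReal p hx]; exact Complex.ofReal_im _

theorem right (G : Admissible D f) (p : ℝ) :
    Branch D (fun _ => (((-lam f) ^ p : ℝ) : ℂ)⁻¹) (fun z => f ((lam f : ℂ) * z)) where
  mapsTo := G.image
  cont := G.continuousOn_image
  diff := G.diff_image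
  real := fun x hx => by rw [← G.ofReal_scaledImage hx]; exact Complex.ofReal_im _
  weight_cont := continuousOn_const
  weight_diff := differentiableOn_const _
  weight_real := fun x _ => by rw [← Complex.ofReal_inv]; exact Complex.ofReal_im _

theorem realTrace_image (f : ℂ → ℂ) :
    realTrace (fun z => f ((lam f : ℂ) * z)) = scaledImage f := by
  funext x
  simp [realTrace, scaledImage]

theorem realTrace_leftWeight (G : Admissible D f) (p : ℝ) {x : ℝ} (hx : (x : ℂ) ∈ D) :
    realTrace (leftWeight f p) x = (intervalWeight f x / -lam f) ^ p := by
  rw [realTrace, G.leftWeight_ofReal p hx, Complex.ofReal_re]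

theorem realTrace_rightWeight (G : Admissible D f) (p x : ℝ) :
    realTrace (fun _ => (((-lam f) ^ p : ℝ) : ℂ)⁻¹) x = (-lam f)⁻¹ ^ p := by
  have h2 := G.lam_neg
  rw [realTrace, ← Complex.ofReal_inv, Complex.ofReal_re, Real.inv_rpow (by linarith)]

theorem branchPair (G : Admissible D f) (p : ℝ) :
    BranchPair D (lam f) (leftWeight f p) (fun _ => (((-lam f) ^ p : ℝ) : ℂ)⁻¹)
      (fun z => f ((lam f : ℂ) * z)) where
  isOpen := G.isOpen
  isPreconnected := G.isPreconnected
  isBounded := G.isBounded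
  interval_subset := G.interval_subset
  ratio_ne := G.lam_neg.ne
  ratio_lt := G.lam_abs_lt
  left := G.left p
  right := G.right p
  mapsTo := by rw [realTrace_image]; exact G.mapsTo
  map_zero := by rw [realTrace_image]; exact scaledImage_zero f G
  left_pos := fun x hx => by
    have hD := G.interval_subset x hx
    rw [G.realTrace_leftWeight p hD]
    exact Real.rpow_pos_of_pos (div_pos (G.intervalWeight_pos hD) (neg_pos.2 G.lam_neg)) p
  right_pos := fun x _ => by
    rw [G.realTrace_rightWeight]
    exact Real.rpow_pos_of_pos (inv_pos.2 (neg_pos.2 G.lam_neg)) p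

theorem isLindebergLyapunov_op (G : Admissible D f) (p : ℝ) :
    IsLindebergLyapunov D f p (G.branchPair p).op where
  scale := G.scale
  image := G.image
  weight := G.weight
  formula := fun h z => by
    rw [← zeroExt_apply (((G.branchPair p).op h).1) z, (G.branchPair p).zeroExt_op h z.2,
      leftWeight]
    ring

theorem isLindebergLyapunov (G : Admissible D f) (p : ℝ) :
    IsLindebergLyapunov D f p (lindebergLyapunov D f p) := by
  rw [lindebergLyapunov_eq (G.isLindebergLyapunov_op p)]
  exact G.isLindebergLyapunov_op p

theorem exists_eigenFamily (G : Admissible D f) (hw : ∀ x ∈ unitI, 1 < intervalWeight f x) :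
    ∃ h, EigenFamily (-lam f) (scaledImage f) (intervalWeight f) (rho D f) h := by
  choose h hc hpos heig using fun p : ℝ => (G.branchPair p).exists_positive_eigenfunction
  have hl := G.lam_abs_lt
  rw [abs_of_neg G.lam_neg] at hl
  refine ⟨h, neg_pos.2 G.lam_neg, hl, G.mapsTo, scaledImage_zero f G, hw, fun p _ => hc p,
    fun p _ => hpos p, fun p _ x hx => ?_⟩
  have h1 := heig p x hx
  rw [realTrace_image, G.realTrace_leftWeight p (G.interval_subset x hx),
    G.realTrace_rightWeight] at h1
  rw [neg_neg, h1, rho, lindebergLyapunov_eq (G.isLindebergLyapunov_op p)]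

end Admissible

/-! ### Bounds on the weight from a bound on the second derivative -/

section WeightBounds

variable {D : Set ℂ} {f : ℂ → ℂ}

theorem deriv_le_of_second_deriv_le (hO : IsOpen D) (hI : ∀ x ∈ unitI, (x : ℂ) ∈ D)
    (hf : DifferentiableOn ℂ f D) {η : ℝ}
    (h2 : ∀ x ∈ unitI, realTrace (deriv (deriv f)) x ≤ η) {y : ℝ} (hy : y ∈ unitI) :
    realTrace (deriv f) 1 - realTrace (deriv f) y ≤ η * (1 - y) := by
  have hd : ∀ x ∈ unitI, HasDerivAt (realTrace (deriv f)) (realTrace (deriv (deriv f)) x) x :=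
    fun x hx => hasDerivAt_realTrace hO (hf.deriv hO) (hI x hx)
  refine (convex_Icc (-1 : ℝ) 1).image_sub_le_mul_sub_of_deriv_le
    (fun x hx => (hd x hx).continuousAt.continuousWithinAt)
    (fun x hx => (hd x (interior_subset hx)).differentiableAt.differentiableWithinAt)
    (fun x hx => ?_) y hy 1 (by simp) hy.2
  rw [(hd x (interior_subset hx)).deriv]
  exact h2 x (interior_subset hx)

/-- The maximum at `0` gives `f' 0 = 0`; two applications of the mean value theorem on `[0, 1]` and
evenness finish. The factor `1 / 2` of Taylor's formula is given up. -/
theorem one_sub_le_of_second_deriv_ge (hO : IsOpen D) (hI : ∀ x ∈ unitI, (x : ℂ) ∈ D)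
    (hf : DifferentiableOn ℂ f D) (R : Renormalizable (realTrace f)) {C : ℝ}
    (h2 : ∀ x ∈ unitI, -C ≤ realTrace (deriv (deriv f)) x) {t : ℝ} (ht : t ∈ unitI) :
    1 - realTrace f t ≤ C * t ^ 2 := by
  have hsub : Icc (0 : ℝ) 1 ⊆ unitI := Icc_subset_Icc_left (by norm_num)
  have h0 : (0 : ℝ) ∈ unitI := by simp
  have hd1 : ∀ x ∈ unitI, HasDerivAt (realTrace f) (realTrace (deriv f) x) x :=
    fun x hx => hasDerivAt_realTrace hO hf (hI x hx)
  have hd2 : ∀ x ∈ unitI, HasDerivAt (realTrace (deriv f)) (realTrace (deriv (deriv f)) x) x :=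
    fun x hx => hasDerivAt_realTrace hO (hf.deriv hO) (hI x hx)
  have hcrit : realTrace (deriv f) 0 = 0 := by
    have hmax : IsLocalMax (realTrace f) 0 := by
      filter_upwards [Icc_mem_nhds (by norm_num : (-1 : ℝ) < 0) (by norm_num : (0 : ℝ) < 1)]
        with x hx
      rw [R.map_zero]
      exact (R.mapsTo hx).2
    exact hmax.hasDerivAt_eq_zero (hd1 0 h0)
  have hC : ∀ x ∈ Icc (0 : ℝ) 1, -C * x ≤ realTrace (deriv f) x := by
    intro x hx
    have := (convex_Icc (0 : ℝ) 1).mul_sub_le_image_sub_of_le_deriv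
      (fun x hx => (hd2 x (hsub hx)).continuousAt.continuousWithinAt)
      (fun x hx => (hd2 x (hsub (interior_subset hx))).differentiableAt.differentiableWithinAt)
      (C := -C) (fun x hx => by
        rw [(hd2 x (hsub (interior_subset hx))).deriv]
        exact h2 x (hsub (interior_subset hx))) 0 ⟨le_rfl, zero_le_one⟩ x hx hx.1
    rw [hcrit] at this
    linarith
  have hC0 : 0 ≤ C := by
    have h3 := h2 0 h0
    by_contra! hneg
    have := hC 1 ⟨zero_le_one, le_rfl⟩
    have h4 := R.unimodal 1 (by simp) one_ne_zero
    rw [(hd1 1 (by simp)).deriv] at h4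
    linarith
  rw [← R.map_abs ht, ← sq_abs]
  have hat : |t| ∈ Icc (0 : ℝ) 1 := ⟨abs_nonneg _, abs_le.2 ht⟩
  have hmono := (convex_Icc (0 : ℝ) 1).image_sub_le_mul_sub_of_deriv_le
    (f := fun x => -realTrace f x - C * x ^ 2) (C := 0)
    (fun x hx => ((hd1 x (hsub hx)).continuousAt.neg.sub (by fun_prop)).continuousWithinAt)
    (fun x hx => ((hd1 x (hsub (interior_subset hx))).differentiableAt.neg.sub
      (by fun_prop)).differentiableWithinAt)
    (fun x hx => by
      have hx' := interior_subset hx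
      have e : HasDerivAt (fun x => -realTrace f x - C * x ^ 2)
          (-realTrace (deriv f) x - C * (2 * x)) x := by
        refine HasDerivAt.congr_deriv
          (((hd1 x (hsub hx')).neg).sub ((hasDerivAt_pow 2 x).const_mul C)) ?_
        norm_num
      rw [e.deriv]
      have := hC x hx'
      nlinarith [mul_nonneg hC0 hx'.1]) 0 ⟨le_rfl, zero_le_one⟩ |t| hat hat.1
  simp only [R.map_zero] at hmono
  linarith

/-- Near `0`, an upper bound on `f''` bounds the weight by a quadratic multiple of its value at
`0`. -/
theorem Admissible.weight_near (G : Admissible D f) {η C δ q : ℝ} (hη : 0 ≤ η) (hC : 0 ≤ C)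
    (hδ : 0 ≤ δ)
    (hle : ∀ x ∈ unitI, realTrace (deriv (deriv f)) x ≤ η)
    (hge : ∀ x ∈ unitI, -C ≤ realTrace (deriv (deriv f)) x) (hq : lam f ^ 2 ≤ q)
    (hsmall : η * C * (1 + δ) ≤ δ * (1 - q)) (hw : 1 ≤ intervalWeight f 0) {x : ℝ}
    (hx : x ∈ unitI) :
    intervalWeight f x * (1 + δ * (-lam f * x) ^ 2) ≤ intervalWeight f 0 * (1 + δ * x ^ 2) := by
  have h1 := deriv_le_of_second_deriv_le G.isOpen G.interval_subset G.diff hle (G.mapsTo hx)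
  have h2 := one_sub_le_of_second_deriv_ge G.isOpen G.interval_subset G.diff G.renormalizable hge
    (G.renormalizable.scale_mem hx)
  have h3 : intervalWeight f 0 = -realTrace (deriv f) 1 := by
    rw [intervalWeight, Admissible.scaledImage_zero f G]
  have h4 : 1 - scaledImage f x ≤ C * (lam f * x) ^ 2 := h2
  set W := intervalWeight f 0
  have hx2 : x ^ 2 ≤ 1 := (sq_le_one_iff_abs_le_one x).2 (abs_le.2 hx)
  have hx0 := sq_nonneg x
  have hl2 : lam f ^ 2 ≤ 1 := (sq_le_one_iff_abs_le_one _).2 G.lam_abs_lt.le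
  have hl0 := sq_nonneg (lam f)
  have e : (-lam f * x) ^ 2 = lam f ^ 2 * x ^ 2 := by ring
  have e' : (lam f * x) ^ 2 = lam f ^ 2 * x ^ 2 := by ring
  rw [e'] at h4
  rw [e]
  -- The weight grows by at most `η` times the distance of `σ x` from `1`, and this distance is at
  -- most `C * x ^ 2`.
  have h5 : intervalWeight f x ≤ W + η * C * x ^ 2 := by
    have g1 : η * (1 - scaledImage f x) ≤ η * (C * (lam f ^ 2 * x ^ 2)) :=
      mul_le_mul_of_nonneg_left h4 hη
    have g2 : η * (C * (lam f ^ 2 * x ^ 2)) ≤ η * (C * x ^ 2) := by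
      gcongr
      exact mul_le_of_le_one_left hx0 hl2
    have g3 : intervalWeight f x = -realTrace (deriv f) (scaledImage f x) := rfl
    linarith
  have h6 : 0 ≤ δ * (lam f ^ 2 * x ^ 2) := by positivity
  calc intervalWeight f x * (1 + δ * (lam f ^ 2 * x ^ 2))
      ≤ (W + η * C * x ^ 2) * (1 + δ * (lam f ^ 2 * x ^ 2)) := by gcongr
    _ = W * (1 + δ * (lam f ^ 2 * x ^ 2)) +
        η * C * x ^ 2 * (1 + δ * (lam f ^ 2 * x ^ 2)) := by ring
    _ ≤ W * (1 + δ * (q * x ^ 2)) + η * C * x ^ 2 * (1 + δ * 1) := by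
        gcongr
        exact mul_le_one₀ hl2 hx0 hx2
    _ = W * (1 + δ * (q * x ^ 2)) + (η * C * (1 + δ)) * x ^ 2 := by ring
    _ ≤ W * (1 + δ * (q * x ^ 2)) + (δ * (1 - q)) * x ^ 2 := by gcongr
    _ ≤ W * (1 + δ * (q * x ^ 2)) + W * (δ * (1 - q)) * x ^ 2 := by
        have h7 : 0 ≤ δ * (1 - q) := le_trans (by positivity) hsmall
        have h8 := mul_le_mul_of_nonneg_right (le_mul_of_one_le_left h7 hw) hx0
        linarith
    _ = _ := by ring

end WeightBounds

end PeriodDoubling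

namespace PeriodDoubling

open Filter Topology

variable {k : ℕ} {D : Set ℂ} {g : ℂ → ℂ}

theorem MemClass.differentiableOn {f : ℂ → ℂ} (M : MemClass k D f) : DifferentiableOn ℂ f D := by
  obtain ⟨q, hq, hf⟩ := M.factor
  refine (((differentiableOn_const (1 : ℂ)).add
    ((differentiable_id.pow (2 * k)).differentiableOn.mul hq.differentiableOn))).congr
    fun z hz => ?_
  rw [hf z (subset_closure hz)]
  rfl

/-! ### The fixed point -/

namespace IsFixedPoint

theorem admissible (H : IsFixedPoint k g D) : Admissible D g := by
  have hdiff := H.memClass.differentiableOn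
  have hscale : ∀ z ∈ closure D, (lam g : ℂ) * z ∈ D := fun z hz =>
    H.closure_scale (image_closure_subset_closure_image
      (f := fun z : ℂ => (lam g : ℂ) * z) (by fun_prop) (mem_image_of_mem _ hz))
  have hcont : ContinuousOn (fun z => g ((lam g : ℂ) * z)) (closure D) :=
    hdiff.continuousOn.comp (by fun_prop) hscale
  have himage : ∀ z ∈ closure D, g ((lam g : ℂ) * z) ∈ D := fun z hz =>
    H.closure_image (hcont.image_closure (mem_image_of_mem _ hz))
  have hcont' : ContinuousOn (fun z => -deriv g (g ((lam g : ℂ) * z))) (closure D) :=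
    ((hdiff.deriv H.isOpen).continuousOn.comp hcont himage).neg
  exact
    { isOpen := H.isOpen
      isPreconnected := H.isConnected.isPreconnected
      isBounded := H.isBounded
      interval_subset := H.interval_subset
      diff := hdiff
      real := H.memClass.real
      renormalizable := H.memClass.renormalizable
      scale := hscale
      image := himage
      weight := fun z hz => H.closure_weight (hcont'.image_closure (mem_image_of_mem _ hz)) }

theorem hasDerivAt (H : IsFixedPoint k g D) {x : ℝ} (hx : x ∈ unitI) :
    HasDerivAt (realTrace g) (realTrace (deriv g) x) x :=
  hasDerivAt_realTrace H.isOpen H.admissible.diff (H.interval_subset x hx)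

theorem hasDerivAt_deriv (H : IsFixedPoint k g D) {x : ℝ} (hx : x ∈ unitI) :
    HasDerivAt (realTrace (deriv g)) (realTrace (deriv (deriv g)) x) x :=
  hasDerivAt_realTrace H.isOpen (H.admissible.diff.deriv H.isOpen) (H.interval_subset x hx)

theorem antitoneOn_deriv (H : IsFixedPoint k g D) : AntitoneOn (realTrace (deriv g)) unitI := by
  intro x hx y hy hxy
  rcases hxy.eq_or_lt with rfl | hlt
  · exact le_rfl
  · exact (H.concave.le_slope_of_hasDerivAt hx hy hlt (H.hasDerivAt hy)).trans
      (H.concave.slope_le_of_hasDerivAt hx hy hlt (H.hasDerivAt hx))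

theorem second_deriv_nonpos (H : IsFixedPoint k g D) {x : ℝ} (hx : x ∈ unitI) :
    realTrace (deriv (deriv g)) x ≤ 0 := by
  rw [← (H.hasDerivAt_deriv hx).hasDerivWithinAt.derivWithin
    (uniqueDiffOn_Icc (by norm_num) x hx)]
  exact H.antitoneOn_deriv.derivWithin_nonpos

/-- By concavity, equality would make `g'` constant on `[y, 1]`, and the Schwarzian would vanish
there. -/
theorem deriv_one_lt (H : IsFixedPoint k g D) {y : ℝ} (hy0 : 0 < y) (hy1 : y < 1) :
    realTrace (deriv g) 1 < realTrace (deriv g) y := by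
  have hy : y ∈ unitI := ⟨by linarith, hy1.le⟩
  by_contra! hle
  have hconst : ∀ x ∈ Icc y 1, realTrace (deriv g) x = realTrace (deriv g) 1 := by
    intro x hx
    have hxI : x ∈ unitI := ⟨by linarith [hx.1], hx.2⟩
    exact le_antisymm ((H.antitoneOn_deriv hy hxI hx.1).trans hle)
      (H.antitoneOn_deriv hxI (by simp) hx.2)
  obtain ⟨t, hyt, ht1⟩ := exists_between hy1
  have e1 : deriv (realTrace g) =ᶠ[𝓝 t] fun _ => realTrace (deriv g) 1 := by
    filter_upwards [Ioo_mem_nhds hyt ht1] with x hx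
    rw [(H.hasDerivAt ⟨by linarith [hx.1], hx.2.le⟩).deriv]
    exact hconst x ⟨hx.1.le, hx.2.le⟩
  have e2 : deriv (deriv (realTrace g)) =ᶠ[𝓝 t] fun _ => 0 := by
    simpa using e1.deriv
  have e3 : deriv (deriv (deriv (realTrace g))) =ᶠ[𝓝 t] fun _ => 0 := by
    simpa using e2.deriv
  have hS := H.memClass.renormalizable.schwarzian_neg t ⟨by linarith, ht1.le⟩ (by linarith)
  rw [schwarzian, iteratedDeriv_succ, iteratedDeriv_succ, iteratedDeriv_one, e3.eq_of_nhds,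
    e2.eq_of_nhds] at hS
  simp at hS

theorem scaledImage_mem (H : IsFixedPoint k g D) {x : ℝ} (hx : x ∈ unitI) :
    realTrace g (lam g) ≤ scaledImage g x ∧ scaledImage g x ≤ 1 :=
  ⟨H.memClass.renormalizable.le_scaled_image hx, (H.admissible.mapsTo hx).2⟩

theorem lam_lt (H : IsFixedPoint k g D) : -lam g < realTrace g (lam g) := by
  have R := H.memClass.renormalizable
  have := R.lam_lt
  rwa [R.abs_lam] at this

/-- With `b = g (λ_g) = g (-λ_g)` and `g b < -λ_g < b`, the chord of `g` over `[-λ_g, b]` has slope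
below `-1`. Concavity carries this bound to `g'` on `[b, 1]`, which contains the image of
`scaledImage g`. -/
theorem one_lt_intervalWeight (H : IsFixedPoint k g D) {x : ℝ} (hx : x ∈ unitI) :
    1 < intervalWeight g x := by
  have R := H.memClass.renormalizable
  have hln : lam g < 0 := R.lam_neg
  have hl := H.lam_lt
  set b := realTrace g (lam g) with hb
  have hl1 : -lam g ∈ unitI := by
    have := R.abs_lam_lt_one
    rw [R.abs_lam] at this
    exact ⟨by linarith, this.le⟩
  have hbI : b ∈ unitI := R.mapsTo R.lam_mem
  have h1 := H.concave.le_slope_of_hasDerivAt hl1 hbI hl (H.hasDerivAt hbI)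
  have heven : realTrace g (-lam g) = b := R.even _ R.lam_mem
  rw [slope_def_field, heven] at h1
  have h2 : realTrace g b < -lam g := by
    have := R.image_lt
    rwa [R.abs_lam] at this
  have h3 : (realTrace g b - b) / (b - -lam g) < -1 := by
    rw [div_lt_iff₀ (by linarith)]
    linarith
  have h4 := H.antitoneOn_deriv hbI (H.admissible.mapsTo hx) (H.scaledImage_mem hx).1
  rw [intervalWeight]
  linarith

theorem intervalWeight_lt (H : IsFixedPoint k g D) {x : ℝ} (hx : x ∈ unitI) (hx0 : x ≠ 0) :
    intervalWeight g x < intervalWeight g 0 := by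
  have hln : lam g < 0 := H.admissible.lam_neg
  rw [intervalWeight, intervalWeight, Admissible.scaledImage_zero g H.admissible]
  refine neg_lt_neg (H.deriv_one_lt ?_ (H.memClass.renormalizable.scaled_image_lt_one hx hx0))
  linarith [H.lam_lt, (H.scaledImage_mem hx).1]

/-- The multiplier of the fixed point of order `2k`. -/
theorem lam_pow_mul (hk : 1 ≤ k) (H : IsFixedPoint k g D) :
    lam g ^ (2 * k) * ((lam g)⁻¹ * deriv (realTrace g) 1) = 1 := by
  have R := H.memClass.renormalizable
  have hln : lam g < 0 := R.lam_neg
  obtain ⟨h, han, hne, hgh⟩ := H.order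
  have hk0 : 2 * k ≠ 0 := by omega
  have h0 : h 0 = 1 := by
    have := hgh 0 (by simp)
    rw [zero_pow hk0, R.map_zero] at this
    exact this.symm
  set c := lam g ^ (2 * k) with hc
  -- The fixed point equation in the variable `t = x ^ (2 * k)`. In this variable the derivative at
  -- `0` is `h' 0 ≠ 0`, which can be cancelled; only one-sided derivatives are available.
  have hfun : EqOn (fun t => realTrace g (h (c * t))) (fun t => lam g * h t) (Icc 0 1) := by
    intro t ht
    set x := t ^ ((2 * k : ℕ) : ℝ)⁻¹ with hx
    have hxk : x ^ (2 * k) = t := Real.rpow_inv_natCast_pow ht.1 hk0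
    have hxI : x ∈ unitI := ⟨by linarith [Real.rpow_nonneg ht.1 ((2 * k : ℕ) : ℝ)⁻¹],
      Real.rpow_le_one ht.1 ht.2 (by positivity)⟩
    have h1 : realTrace g (realTrace g (lam g * x)) / lam g = realTrace g x := H.fixed x hxI
    rw [div_eq_iff hln.ne] at h1
    have h2 : realTrace g (lam g * x) = h ((lam g * x) ^ (2 * k)) := hgh _ (R.scale_mem hxI)
    rw [mul_pow, hxk] at h2
    rw [h2, hgh x hxI, hxk] at h1
    exact h1.trans (mul_comm _ _)
  have hh : HasDerivAt h (deriv h 0) 0 := (han 0 (by simp)).differentiableAt.hasDerivAt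
  have hL : HasDerivAt (fun t => realTrace g (h (c * t)))
      (realTrace (deriv g) 1 * (deriv h 0 * c)) 0 := by
    have e1 : HasDerivAt (fun t : ℝ => c * t) c 0 := by
      simpa using (hasDerivAt_id (0 : ℝ)).const_mul c
    have e2 : HasDerivAt (fun t : ℝ => h (c * t)) (deriv h 0 * c) 0 :=
      HasDerivAt.comp (h₂ := h) 0 (by rwa [mul_zero]) e1
    exact HasDerivAt.comp (h₂ := realTrace g) 0
      (by rw [mul_zero, h0]; exact H.hasDerivAt (by simp)) e2
  have hR : HasDerivAt (fun t => lam g * h t) (lam g * deriv h 0) 0 := hh.const_mul _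
  have huniq : UniqueDiffWithinAt ℝ (Icc (0 : ℝ) 1) 0 :=
    uniqueDiffOn_Icc zero_lt_one 0 (by simp)
  have heq := huniq.eq_deriv _ hL.hasDerivWithinAt
    (hR.hasDerivWithinAt.congr hfun (hfun (by simp)))
  rw [(H.hasDerivAt (by simp : (1 : ℝ) ∈ unitI)).deriv]
  have h3 : realTrace (deriv g) 1 * c = lam g := by
    refine mul_right_cancel₀ hne ?_
    linarith
  have := hln.ne
  field_simp
  linarith

theorem mem_stableManifold (H : IsFixedPoint k g D) : g ∈ stableManifold k g D :=
  ⟨fun _ => g, rfl, fun _ => H.memClass, fun _ x hx => (H.fixed x hx).symm, 0, 1 / 2, by norm_num,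
    by norm_num, fun n z _ => by simp⟩

end IsFixedPoint

/-! ### Maps close to the fixed point -/

/-- The filter of maps in `(𝒢_k + 1) ∩ 𝒫` that are uniformly close to `g` on the closure of `D`. -/
def nearFilter (k : ℕ) (D : Set ℂ) (g : ℂ → ℂ) : Filter (ℂ → ℂ) :=
  ⨅ ε ∈ Ioi (0 : ℝ), 𝓟 {f | MemClass k D f ∧ ∀ z ∈ closure D, ‖f z - g z‖ < ε}

theorem eventually_nearFilter {P : (ℂ → ℂ) → Prop} :
    (∀ᶠ f in nearFilter k D g, P f) ↔
      ∃ ε > 0, ∀ f, MemClass k D f → (∀ z ∈ closure D, ‖f z - g z‖ < ε) → P f := by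
  have hb : (nearFilter k D g).HasBasis (fun ε => ε ∈ Ioi (0 : ℝ))
      fun ε => {f | MemClass k D f ∧ ∀ z ∈ closure D, ‖f z - g z‖ < ε} := by
    refine hasBasis_biInf_principal ?_ ⟨1, mem_Ioi.2 one_pos⟩
    intro a ha b hb
    refine ⟨min a b, mem_Ioi.2 (lt_min ha hb), fun f hf => ⟨hf.1, fun z hz => ?_⟩,
      fun f hf => ⟨hf.1, fun z hz => ?_⟩⟩
    · exact (hf.2 z hz).trans_le (min_le_left _ _)
    · exact (hf.2 z hz).trans_le (min_le_right _ _)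
  rw [hb.eventually_iff]
  constructor
  · rintro ⟨ε, hε, h⟩
    exact ⟨ε, hε, fun f h1 h2 => h ⟨h1, h2⟩⟩
  · rintro ⟨ε, hε, h⟩
    exact ⟨ε, hε, fun f hf => h f hf.1 hf.2⟩

theorem eventually_memClass : ∀ᶠ f in nearFilter k D g, MemClass k D f :=
  eventually_nearFilter.2 ⟨1, one_pos, fun _ h _ => h⟩

theorem tendstoLocallyUniformlyOn_near :
    TendstoLocallyUniformlyOn (fun f : ℂ → ℂ => f) g (nearFilter k D g) D := by
  apply TendstoUniformlyOn.tendstoLocallyUniformlyOn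
  rw [Metric.tendstoUniformlyOn_iff]
  intro ε hε
  refine eventually_nearFilter.2 ⟨ε, hε, fun f _ hf z hz => ?_⟩
  rw [dist_comm, dist_eq_norm]
  exact hf z (subset_closure hz)

/-- Joint convergence in map and point is what composed expressions such as `f (λ_f z)`, with moving
arguments, require. -/
theorem tendsto_eval_of_tendstoLocallyUniformlyOn {ι : Type*} {F : ι → ℂ → ℂ} {G : ℂ → ℂ}
    {l : Filter ι} (hO : IsOpen D) (h : TendstoLocallyUniformlyOn F G l D) (hG : ContinuousOn G D)
    {z : ℂ} (hz : z ∈ D) : Tendsto (fun p : ι × ℂ => F p.1 p.2) (l ×ˢ 𝓝 z) (𝓝 (G z)) := by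
  have h1 := (hO.tendstoLocallyUniformlyOn_iff_forall_tendsto.1 h) z hz
  have h2 : Tendsto (fun p : ι × ℂ => G p.2) (l ×ˢ 𝓝 z) (𝓝 (G z)) :=
    (hG.continuousAt (hO.mem_nhds hz)).tendsto.comp tendsto_snd
  exact h2.congr_uniformity h1

theorem eventually_forall_mem_of_isCompact {ι X : Type*} [TopologicalSpace X] {l : Filter ι}
    {K : Set X} (hK : IsCompact K) {P : ι → X → Prop}
    (h : ∀ x ∈ K, ∀ᶠ p in l ×ˢ 𝓝 x, P p.1 p.2) : ∀ᶠ i in l, ∀ x ∈ K, P i x := by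
  have h1 : {p : ι × X | P p.1 p.2} ∈ l ×ˢ 𝓝ˢ K := hK.mem_prod_nhdsSet_of_forall h
  have h2 : ∀ᶠ p in l ×ˢ 𝓝ˢ K, P p.1 p.2 := h1
  exact h2.curry.mono fun _ h ↦ h.self_of_nhdsSet

theorem Tendsto.realTrace_eval {ι : Type*} {F : ι → ℂ → ℂ} {G : ℂ → ℂ} {l : Filter ι} {x : ℝ}
    (h : Tendsto (fun p : ι × ℂ => F p.1 p.2) (l ×ˢ 𝓝 (x : ℂ)) (𝓝 (G x))) :
    Tendsto (fun p : ι × ℝ => realTrace (F p.1) p.2) (l ×ˢ 𝓝 x) (𝓝 (realTrace G x)) := by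
  have h1 : Tendsto (fun p : ι × ℝ => (p.1, (p.2 : ℂ))) (l ×ˢ 𝓝 x) (l ×ˢ 𝓝 (x : ℂ)) :=
    tendsto_id.prodMap (Complex.continuous_ofReal.tendsto x)
  exact (Complex.continuous_re.tendsto _).comp (h.comp h1)

namespace IsFixedPoint

theorem tendsto_eval (H : IsFixedPoint k g D) {z : ℂ} (hz : z ∈ D) :
    Tendsto (fun p : (ℂ → ℂ) × ℂ => p.1 p.2) (nearFilter k D g ×ˢ 𝓝 z) (𝓝 (g z)) :=
  tendsto_eval_of_tendstoLocallyUniformlyOn H.isOpen tendstoLocallyUniformlyOn_near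
    H.admissible.diff.continuousOn hz

theorem tendstoLocallyUniformlyOn_deriv (H : IsFixedPoint k g D) :
    TendstoLocallyUniformlyOn (fun f : ℂ → ℂ => deriv f) (deriv g) (nearFilter k D g) D :=
  tendstoLocallyUniformlyOn_near.deriv (eventually_memClass.mono fun _ h => h.differentiableOn)
    H.isOpen

theorem tendsto_eval_deriv (H : IsFixedPoint k g D) {z : ℂ} (hz : z ∈ D) :
    Tendsto (fun p : (ℂ → ℂ) × ℂ => deriv p.1 p.2) (nearFilter k D g ×ˢ 𝓝 z) (𝓝 (deriv g z)) :=
  tendsto_eval_of_tendstoLocallyUniformlyOn H.isOpen H.tendstoLocallyUniformlyOn_deriv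
    (H.admissible.diff.deriv H.isOpen).continuousOn hz

theorem tendsto_eval_deriv_deriv (H : IsFixedPoint k g D) {z : ℂ} (hz : z ∈ D) :
    Tendsto (fun p : (ℂ → ℂ) × ℂ => deriv (deriv p.1) p.2) (nearFilter k D g ×ˢ 𝓝 z)
      (𝓝 (deriv (deriv g) z)) :=
  tendsto_eval_of_tendstoLocallyUniformlyOn H.isOpen
    (H.tendstoLocallyUniformlyOn_deriv.deriv
      (eventually_memClass.mono fun _ h => h.differentiableOn.deriv H.isOpen) H.isOpen)
    ((H.admissible.diff.deriv H.isOpen).deriv H.isOpen).continuousOn hz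

theorem tendsto_lam (H : IsFixedPoint k g D) : Tendsto lam (nearFilter k D g) (𝓝 (lam g)) := by
  have h1 := Tendsto.realTrace_eval (F := fun f : ℂ → ℂ => f) (H.tendsto_eval (H.interval_subset 1 (by simp)))
  have h2 : Tendsto (fun f : ℂ → ℂ => (f, (1 : ℝ))) (nearFilter k D g)
      (nearFilter k D g ×ˢ 𝓝 1) := tendsto_id.prodMk tendsto_const_nhds
  exact h1.comp h2

theorem tendsto_scale (H : IsFixedPoint k g D) (z : ℂ) :
    Tendsto (fun p : (ℂ → ℂ) × ℂ => (lam p.1 : ℂ) * p.2) (nearFilter k D g ×ˢ 𝓝 z)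
      (𝓝 ((lam g : ℂ) * z)) :=
  (((Complex.continuous_ofReal.tendsto _).comp H.tendsto_lam).comp tendsto_fst).mul tendsto_snd

theorem tendsto_image (H : IsFixedPoint k g D) {z : ℂ} (hz : z ∈ closure D) :
    Tendsto (fun p : (ℂ → ℂ) × ℂ => p.1 ((lam p.1 : ℂ) * p.2)) (nearFilter k D g ×ˢ 𝓝 z)
      (𝓝 (g ((lam g : ℂ) * z))) :=
  (H.tendsto_eval (H.admissible.scale z hz)).comp (tendsto_fst.prodMk (H.tendsto_scale z))

theorem tendsto_weight (H : IsFixedPoint k g D) {z : ℂ} (hz : z ∈ closure D) :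
    Tendsto (fun p : (ℂ → ℂ) × ℂ => -deriv p.1 (p.1 ((lam p.1 : ℂ) * p.2)))
      (nearFilter k D g ×ˢ 𝓝 z) (𝓝 (-deriv g (g ((lam g : ℂ) * z)))) :=
  ((H.tendsto_eval_deriv (H.admissible.image z hz)).comp
    (tendsto_fst.prodMk (H.tendsto_image hz))).neg

theorem tendsto_scaledImage (H : IsFixedPoint k g D) {x : ℝ} (hx : x ∈ unitI) :
    Tendsto (fun p : (ℂ → ℂ) × ℝ => scaledImage p.1 p.2) (nearFilter k D g ×ˢ 𝓝 x)
      (𝓝 (scaledImage g x)) :=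
  (Tendsto.realTrace_eval (F := fun f : ℂ → ℂ => f) (x := lam g * x) (H.tendsto_eval
    (H.interval_subset _ (H.memClass.renormalizable.scale_mem hx)))).comp
    (tendsto_fst.prodMk ((H.tendsto_lam.comp tendsto_fst).mul tendsto_snd))

theorem tendsto_intervalWeight (H : IsFixedPoint k g D) {x : ℝ} (hx : x ∈ unitI) :
    Tendsto (fun p : (ℂ → ℂ) × ℝ => intervalWeight p.1 p.2) (nearFilter k D g ×ˢ 𝓝 x)
      (𝓝 (intervalWeight g x)) :=
  ((Tendsto.realTrace_eval (F := fun f : ℂ → ℂ => deriv f) (H.tendsto_eval_deriv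
    (H.interval_subset _ (H.admissible.mapsTo hx)))).comp
    (tendsto_fst.prodMk (H.tendsto_scaledImage hx))).neg

theorem tendsto_intervalWeight_zero (H : IsFixedPoint k g D) :
    Tendsto (fun f => intervalWeight f 0) (nearFilter k D g) (𝓝 (intervalWeight g 0)) :=
  (H.tendsto_intervalWeight EigenFamily.zero_mem).comp
    (tendsto_id.prodMk (tendsto_const_nhds (x := (0 : ℝ))))

theorem eventually_admissible (H : IsFixedPoint k g D) :
    ∀ᶠ f in nearFilter k D g, Admissible D f := by
  have hK := H.isBounded.isCompact_closure
  have G := H.admissible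
  filter_upwards [eventually_memClass,
    eventually_forall_mem_of_isCompact (P := fun f z => (lam f : ℂ) * z ∈ D) hK fun z hz =>
      (H.tendsto_scale z).eventually (H.isOpen.mem_nhds (G.scale z hz)),
    eventually_forall_mem_of_isCompact (P := fun f z => f ((lam f : ℂ) * z) ∈ D) hK fun z hz =>
      (H.tendsto_image hz).eventually (H.isOpen.mem_nhds (G.image z hz)),
    eventually_forall_mem_of_isCompact (P := fun f z =>
      -deriv f (f ((lam f : ℂ) * z)) ∈ Complex.slitPlane) hK fun z hz =>
      (H.tendsto_weight hz).eventually (Complex.isOpen_slitPlane.mem_nhds (G.weight z hz))]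
    with f hM h1 h2 h3
  exact
    { isOpen := H.isOpen
      isPreconnected := G.isPreconnected
      isBounded := H.isBounded
      interval_subset := H.interval_subset
      diff := hM.differentiableOn
      real := hM.real
      renormalizable := hM.renormalizable
      scale := h1
      image := h2
      weight := h3 }

theorem eventually_one_lt_intervalWeight (H : IsFixedPoint k g D) :
    ∀ᶠ f in nearFilter k D g, ∀ x ∈ unitI, 1 < intervalWeight f x :=
  eventually_forall_mem_of_isCompact (P := fun f x => 1 < intervalWeight f x) isCompact_Icc
    fun _ hx =>
    (H.tendsto_intervalWeight hx).eventually_const_lt (H.one_lt_intervalWeight hx)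

theorem continuousOn_intervalWeight (H : IsFixedPoint k g D) :
    ContinuousOn (intervalWeight g) unitI := by
  have h1 : ContinuousOn (scaledImage g) unitI :=
    ContinuousOn.comp H.memClass.renormalizable.continuousOn (by fun_prop)
      fun x hx => H.memClass.renormalizable.scale_mem hx
  have h2 : ContinuousOn (realTrace (deriv g)) unitI := fun x hx =>
    (H.hasDerivAt_deriv hx).continuousAt.continuousWithinAt
  exact (h2.comp h1 H.admissible.mapsTo).neg

theorem eventually_weightDominated (H : IsFixedPoint k g D) :
    ∃ s δ θ : ℝ, ∀ᶠ f in nearFilter k D g,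
      EigenFamily.WeightDominated (-lam f) (scaledImage f) (intervalWeight f) s δ θ := by
  have R := H.memClass.renormalizable
  have hln : lam g < 0 := R.lam_neg
  have hbpos : 0 < realTrace g (lam g) := by linarith [H.lam_lt]
  have hb1 : realTrace g (lam g) ≤ 1 := (R.mapsTo R.lam_mem).2
  -- The image of `scaledImage g` lies in `[g (λ_g), 1]`, so any `s` below `g (λ_g)` separates it
  -- from `0`.
  obtain ⟨s, hs0, hsb⟩ := exists_between hbpos
  set W := intervalWeight g 0
  have hW : 1 < W := H.one_lt_intervalWeight EigenFamily.zero_mem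
  have hKc : IsCompact (unitI ∩ {x : ℝ | s ≤ |x|}) :=
    isCompact_Icc.inter_right (isClosed_le continuous_const continuous_abs)
  obtain ⟨x₁, hx₁, hmax⟩ := hKc.exists_isMaxOn
    ⟨1, by simp, by simp only [mem_ofPred_eq, abs_one]; linarith⟩
    (H.continuousOn_intervalWeight.mono inter_subset_left)
  set c := intervalWeight g x₁
  have hcW : c < W := H.intervalWeight_lt hx₁.1 fun h0 => by
    have := hx₁.2
    rw [h0] at this
    simp only [mem_ofPred_eq, abs_zero] at this
    linarith
  -- One small `t` serves as both `δ` and `θ`; the strict gap between `c`, the maximum of the weight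
  -- on `s ≤ |x|`, and `W` leaves room for it.
  obtain ⟨t, htc, ht0, ht1⟩ : ∃ t : ℝ, c * (1 + t) < W * (1 - t) ^ 2 ∧ 0 < t ∧ t < 1 := by
    have hcont : Tendsto (fun t : ℝ => W * (1 - t) ^ 2 - c * (1 + t)) (𝓝 0)
        (𝓝 (W * (1 - 0) ^ 2 - c * (1 + 0))) := Continuous.tendsto (by fun_prop) 0
    have h1 : ∀ᶠ t in 𝓝[>] (0 : ℝ), 0 < W * (1 - t) ^ 2 - c * (1 + t) :=
      nhdsWithin_le_nhds (hcont.eventually_const_lt (by linarith))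
    have h2 : ∀ᶠ t in 𝓝[>] (0 : ℝ), t < 1 := nhdsWithin_le_nhds (eventually_lt_nhds zero_lt_one)
    obtain ⟨t, h3, h4, h5⟩ := (h1.and (h2.and self_mem_nhdsWithin)).exists
    exact ⟨t, by linarith, h5, h4⟩
  have hl2 : lam g ^ 2 < 1 := (sq_lt_one_iff_abs_lt_one _).2 R.abs_lam_lt_one
  obtain ⟨q, hlq, hq1⟩ := exists_between hl2
  have hd2c : ContinuousOn (fun x => -realTrace (deriv (deriv g)) x) unitI := fun x hx =>
    (hasDerivAt_realTrace H.isOpen ((H.admissible.diff.deriv H.isOpen).deriv H.isOpen)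
      (H.interval_subset x hx)).continuousAt.neg.continuousWithinAt
  obtain ⟨B, hB⟩ := exists_bound_of_continuousOn hd2c
  have hB0 : 0 ≤ B := by
    have h1 := hB 0 EigenFamily.zero_mem
    have h2 := H.second_deriv_nonpos EigenFamily.zero_mem
    linarith
  -- Chosen to give equality in the smallness condition of `weight_near` with `C = B + 1`. Since
  -- `g'' ≤ 0`, the bound `f'' < η` holds near `g`.
  set η := t * (1 - q) / ((B + 1) * (1 + t)) with hη_def
  have hη : 0 < η := div_pos (mul_pos ht0 (by linarith)) (by positivity)
  have hηeq : η * (B + 1) * (1 + t) = t * (1 - q) := by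
    rw [hη_def]; field_simp
  have hT2 : ∀ x ∈ unitI, Tendsto (fun p : (ℂ → ℂ) × ℝ => realTrace (deriv (deriv p.1)) p.2)
      (nearFilter k D g ×ˢ 𝓝 x) (𝓝 (realTrace (deriv (deriv g)) x)) := fun x hx =>
    Tendsto.realTrace_eval (F := fun f : ℂ → ℂ => deriv (deriv f))
      (H.tendsto_eval_deriv_deriv (H.interval_subset x hx))
  refine ⟨s, t, t, ?_⟩
  filter_upwards [H.eventually_admissible, H.eventually_one_lt_intervalWeight,
    eventually_forall_mem_of_isCompact (P := fun f x => s < scaledImage f x)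
      isCompact_Icc fun x hx => (H.tendsto_scaledImage hx).eventually_const_lt (hsb.trans_le (H.scaledImage_mem hx).1),
    eventually_forall_mem_of_isCompact (P := fun f x => realTrace (deriv (deriv f)) x < η)
      isCompact_Icc fun x hx => (hT2 x hx).eventually_lt_const ((H.second_deriv_nonpos hx).trans_lt hη),
    eventually_forall_mem_of_isCompact (P := fun f x => -(B + 1) < realTrace (deriv (deriv f)) x)
      isCompact_Icc fun x hx => (hT2 x hx).eventually_const_lt (by linarith [hB x hx] : -(B + 1) < _),
    (H.tendsto_lam.pow 2).eventually_lt_const hlq,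
    eventually_forall_mem_of_isCompact (P := fun f x =>
      intervalWeight f x * (1 + t) < intervalWeight f 0 * (1 - t) ^ 2) hKc fun x hx =>
      ((H.tendsto_intervalWeight hx.1).mul_const (1 + t)).eventually_lt
        ((H.tendsto_intervalWeight_zero.comp tendsto_fst).mul_const ((1 - t) ^ 2))
        ((mul_le_mul_of_nonneg_right (hmax hx) (by linarith)).trans_lt htc)]
    with f G hw himg hup hlow hlam hfar
  exact
    { s_pos := hs0
      δ_pos := ht0
      θ_pos := ht0
      θ_lt := ht1
      image := himg
      near := fun x hx _ => by
        have := G.weight_near hη.le (by linarith : 0 ≤ B + 1) ht0.le (fun x hx => (hup x hx).le)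
          (fun x hx => (hlow x hx).le) hlam.le hηeq.le (hw 0 EigenFamily.zero_mem).le hx
        exact this
      far := fun x hx hsx => (hfar x ⟨hx, hsx.le⟩).le }

end IsFixedPoint

theorem Admissible.weight_ratio {f : ℂ → ℂ} (G : Admissible D f) :
    intervalWeight f 0 / -lam f = (lam f)⁻¹ * deriv (realTrace f) 1 := by
  rw [intervalWeight, scaledImage_zero f G, neg_div_neg_eq,
    (hasDerivAt_realTrace G.isOpen G.diff (G.interval_subset 1 (by simp))).deriv, div_eq_inv_mul]

theorem Admissible.inv_rpow {f : ℂ → ℂ} (G : Admissible D f) (p : ℝ) :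
    (-lam f)⁻¹ ^ p = (-lam f) ^ (-p) := by
  have := G.lam_neg
  rw [Real.inv_rpow (by linarith), Real.rpow_neg (by linarith)]

end PeriodDoubling

theorem theorem6 (k : ℕ) (hk : 1 ≤ k) (g : ℂ → ℂ) (D : Set ℂ)
    (hg : PeriodDoubling.IsFixedPoint k g D) :
    (∃ ε : ℝ, 0 < ε ∧ ∀ f ∈ PeriodDoubling.stableManifold k g D,
      (∀ z ∈ closure D, ‖f z - g z‖ < ε) →
        (∀ p : ℝ, 0 ≤ p → PeriodDoubling.IsLindebergLyapunov D f p
          (PeriodDoubling.lindebergLyapunov D f p)) ∧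
        (∀ p : ℝ, 0 ≤ p →
          ((PeriodDoubling.lam f)⁻¹ * deriv (PeriodDoubling.realTrace f) 1) ^ p
            < PeriodDoubling.rho D f p) ∧
        (∀ p : ℝ, 0 < p →
          PeriodDoubling.rho D f p
            < ((PeriodDoubling.lam f)⁻¹ * deriv (PeriodDoubling.realTrace f) 1) ^ p
              + (-PeriodDoubling.lam f) ^ (-p)) ∧
        StrictMonoOn (fun p : ℝ => PeriodDoubling.rho D f p) (Set.Ici 0) ∧
        StrictConvexOn ℝ (Set.Ici 0) (fun p : ℝ => Real.log (PeriodDoubling.rho D f p)) ∧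
        StrictAntiOn (fun p : ℝ => Real.log (PeriodDoubling.rho D f p) / p) (Set.Ioi 0) ∧
        (∀ p : ℝ, 2 < p →
          PeriodDoubling.rho D f p < PeriodDoubling.rho D f 2 ^ (p / 2))) ∧
    (∀ p : ℝ, 0 ≤ p →
      1 < (PeriodDoubling.lam g ^ (2 * k)) ^ p * PeriodDoubling.rho D g p) ∧
    (∀ p : ℝ, 0 < p →
      (PeriodDoubling.lam g ^ (2 * k)) ^ p * PeriodDoubling.rho D g p
        < 1 + (-PeriodDoubling.lam g) ^ ((2 * (k : ℝ) - 1) * p)) := by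
  obtain ⟨s, δ, θ, hdom⟩ := hg.eventually_weightDominated
  obtain ⟨ε, hε, hP⟩ := PeriodDoubling.eventually_nearFilter.1
    (hg.eventually_admissible.and (hg.eventually_one_lt_intervalWeight.and hdom))
  have main : ∀ f ∈ PeriodDoubling.stableManifold k g D, (∀ z ∈ closure D, ‖f z - g z‖ < ε) →
      PeriodDoubling.Admissible D f ∧ (∀ x ∈ PeriodDoubling.unitI,
        1 < PeriodDoubling.intervalWeight f x) ∧ PeriodDoubling.EigenFamily.WeightDominated
          (-PeriodDoubling.lam f) (PeriodDoubling.scaledImage f)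
          (PeriodDoubling.intervalWeight f) s δ θ := by
    rintro f ⟨F, hF0, hF, -⟩ hclose
    exact hP f (hF0 ▸ hF 0) hclose
  have first : ∀ f ∈ PeriodDoubling.stableManifold k g D, (∀ z ∈ closure D, ‖f z - g z‖ < ε) →
        (∀ p : ℝ, 0 ≤ p → PeriodDoubling.IsLindebergLyapunov D f p
          (PeriodDoubling.lindebergLyapunov D f p)) ∧
        (∀ p : ℝ, 0 ≤ p →
          ((PeriodDoubling.lam f)⁻¹ * deriv (PeriodDoubling.realTrace f) 1) ^ p
            < PeriodDoubling.rho D f p) ∧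
        (∀ p : ℝ, 0 < p →
          PeriodDoubling.rho D f p
            < ((PeriodDoubling.lam f)⁻¹ * deriv (PeriodDoubling.realTrace f) 1) ^ p
              + (-PeriodDoubling.lam f) ^ (-p)) ∧
        StrictMonoOn (fun p : ℝ => PeriodDoubling.rho D f p) (Set.Ici 0) ∧
        StrictConvexOn ℝ (Set.Ici 0) (fun p : ℝ => Real.log (PeriodDoubling.rho D f p)) ∧
        StrictAntiOn (fun p : ℝ => Real.log (PeriodDoubling.rho D f p) / p) (Set.Ioi 0) ∧
        (∀ p : ℝ, 2 < p →
          PeriodDoubling.rho D f p < PeriodDoubling.rho D f 2 ^ (p / 2)) := by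
    intro f hf hclose
    obtain ⟨G, hw, T⟩ := main f hf hclose
    obtain ⟨h, E⟩ := G.exists_eigenFamily hw
    refine ⟨fun p _ => G.isLindebergLyapunov p, fun p hp => ?_, fun p hp => ?_, E.strictMonoOn,
      E.strictConvexOn_log T, E.strictAntiOn_log_div T, fun p hp => E.lt_rpow_half T hp⟩
    · rw [← G.weight_ratio]
      exact E.lower hp
    · rw [← G.weight_ratio, ← G.inv_rpow]
      exact E.upper T hp
  have hgW := first g hg.mem_stableManifold fun z _ => by simpa using hε
  have hln := hg.admissible.lam_neg
  have hlp : 0 < -PeriodDoubling.lam g := neg_pos.2 hln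
  have heven : PeriodDoubling.lam g ^ (2 * k) = (-PeriodDoubling.lam g) ^ (2 * k) :=
    ((even_two_mul k).neg_pow _).symm
  have hc : 0 < PeriodDoubling.lam g ^ (2 * k) := by rw [heven]; positivity
  have hcp : ∀ p : ℝ, 0 < (PeriodDoubling.lam g ^ (2 * k)) ^ p := fun p =>
    Real.rpow_pos_of_pos hc p
  have hmul := hg.lam_pow_mul hk
  have hA : 0 < (PeriodDoubling.lam g)⁻¹ * deriv (PeriodDoubling.realTrace g) 1 := by
    by_contra! hle
    have := mul_nonpos_of_nonneg_of_nonpos hc.le hle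
    linarith
  have hone : ∀ p : ℝ, (PeriodDoubling.lam g ^ (2 * k)) ^ p *
      ((PeriodDoubling.lam g)⁻¹ * deriv (PeriodDoubling.realTrace g) 1) ^ p = 1 := fun p => by
    rw [← Real.mul_rpow hc.le hA.le, hmul, Real.one_rpow]
  refine ⟨⟨ε, hε, first⟩, fun p hp => ?_, fun p hp => ?_⟩
  · rw [← hone p]
    exact mul_lt_mul_of_pos_left (hgW.2.1 p hp) (hcp p)
  · refine (mul_lt_mul_of_pos_left (hgW.2.2.1 p hp) (hcp p)).trans_eq ?_
    -- The exponents `2 * k * p` and `-p` of `-λ_g` combine to `(2 * k - 1) * p`.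
    rw [mul_add, hone p, heven, ← Real.rpow_natCast, ← Real.rpow_mul hlp.le, ← Real.rpow_add hlp]
    congr 2
    push_cast
    ring
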